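/- Let $d\ge 1$, let $M$ be a natural number, let $R>0$, and write $\chi_R$ for the indicator function of the ball $B(0,R)\subset\mathbb R^d$. Let $q\in\{2,\,d+1\}$. For $f=(f_1,\dots,f_M)\in L^2_M:=L^2(\mathbb R^d)^M$ and $m=1,\dots,M$ put $$ Q^R_m(f,f)(v)=\sum_{n=1}^{m-1}\chi_R(v)\int_{\mathbb R^d} f_n\Big(\tfrac{mv-(m-n)w}{n}\Big)f_{m-n}(w)\,|v-w|\,\Big(\frac mn\Big)^{q}\chi_R(w)\,dw-2\sum_{n=1}^M\chi_R(v)\int_{\mathbb R^d} f_m(v)f_n(w)\,|v-w|\,\chi_R(w)\,dw . $$ Let $(P_t)_{t\ge0}$ be the semigroup on $L^2(\mathbb R^d)$ with generator $\mathcal L=\Delta+v\cdot\nabla$, that is, $P_0=\mathrm{Id}$ and, for $t>0$, $$ P_tu(v)=\int_{\mathbb R^d}K(t,w)\,u(e^tv-w)\,dw,\qquad K(t,w)=\big(2\pi(e^{2t}-1)\big)^{-d/2}e^{-|w|^2/(2(e^{2t}-1))}. $$ Consider the truncated problem $$ \partial_t f_m=\operatorname{div}(vf_m)+\Delta f_m+Q^R_m(f,f),\qquad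 f_m|_{t=0}=f^0_m,\qquad m=1,\dots,M. $$ An $L^2$-mild solution on $[0,T]$ is a function $f\in C([0,T],L^2_M)$ with $$ f_m(t)=P_tf^0_m+\int_0^tP_{t-s}\big(d\,f_m(s)+Q^R_m(f(s),f(s))\big)\,ds,\qquad t\in[0,T],\ m=1,\dots,M . $$ A maximal $L^2$-mild solution on $[0,T(f^0))$, with $0<T(f^0)\le\infty$, is a function that is a mild solution on $[0,T]$ for every $0<T<T(f^0)$ and that does not coincide on $[0,T(f^0))$ with a mild solution on any $[0,T]$ with $T\ge T(f^0)$. **Theorem (global existence).** Let $f^0=(f^0_1,\dots,f^0_M)\in L^2_M$ with $f^0_m\ge0$ almost everywhere for every $m$. Then the solution of the truncated problem is global in time, i.e. $T(f^0)=\infty$: there is a maximal $L^2$-mild solution $f$ on $[0,\infty)$, every $L^2$-mild solution on an interval $[0,T]$ coincides with $f$ on $[0,T]$, and every maximal $L^2$-mild solution has $T(f^0)=\infty$. -/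

import Mathlib

open MeasureTheory ProbabilityTheory
open scoped ENNReal

namespace Smoluchowski

/-- The velocity space `ℝ^d` with its Euclidean norm. -/
abbrev Vel (d : ℕ) : Type := EuclideanSpace ℝ (Fin d)

/-- The Lebesgue space `L²(ℝ^d)`. -/
abbrev L2 (d : ℕ) : Type := Lp ℝ 2 (volume : Measure (Vel d))

/-- `L²_M`: families `(f_1, ..., f_M)` of elements of `L²(ℝ^d)`. The index `i : Fin M` stands for
the mass `i + 1`. (The norm of the product is equivalent to the sum of the `L²` norms.) -/
abbrev State (M d : ℕ) : Type := Fin M → L2 d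

/-- The mass, in `{1, ..., M}`, that belongs to an index. -/
def mass {M : ℕ} (i : Fin M) : ℕ := (i : ℕ) + 1

/-- The cutoff `χ_R`: the indicator function of the ball `B(0, R)`. -/
noncomputable def cutoff {d : ℕ} (R : ℝ) (v : Vel d) : ℝ :=
  (Metric.ball (0 : Vel d) R).indicator (fun _ => (1 : ℝ)) v

/-! ### The semigroup generated by `Δ + v · ∇` -/

/-- The semigroup with generator `Δ + v · ∇`, on functions:
`(P_t u)(v) = ∫ u(e^t v - √(e^{2t} - 1) z) dγ(z)` with `γ` the standard Gaussian measure. For `t > 0`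
this is `∫ K(t, w) u(e^t v - w) dw`, where
`K(t, w) = (2π(e^{2t} - 1))^{-d/2} exp(-|w|² / (2(e^{2t} - 1)))`; for `t = 0` it is `u`. -/
noncomputable def semigroupFun {d : ℕ} (t : ℝ) (u : Vel d → ℝ) (v : Vel d) : ℝ :=
  ∫ z, u (Real.exp t • v - Real.sqrt (Real.exp (2 * t) - 1) • z) ∂(stdGaussian (Vel d))

theorem lintegral_affine {d : ℕ} (a : ℝ) (ha : a ≠ 0) :
    ∃ C : ℝ≥0∞, C ≠ ⊤ ∧ ∀ (F : Vel d → ℝ≥0∞), Measurable F → ∀ b : Vel d,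
      ∫⁻ v, F (a • v + b) = C * ∫⁻ v, F v := by
  refine ⟨ENNReal.ofReal |(a ^ Module.finrank ℝ (Vel d))⁻¹|, ENNReal.ofReal_ne_top, ?_⟩
  intro F hF b
  have h1 : ∫⁻ v, F (a • v + b) = ∫⁻ x, F (x + b) ∂(Measure.map (a • ·) volume) := by
    rw [lintegral_map (by fun_prop) (by fun_prop)]
  rw [h1, Measure.map_addHaar_smul _ ha, lintegral_smul_measure, smul_eq_mul,
    lintegral_add_right_eq_self]

theorem memLp_semigroupFun {d : ℕ} (t : ℝ) (u : L2 d) :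
    MemLp (semigroupFun t (u : Vel d → ℝ)) 2 volume := by
  have hu : StronglyMeasurable (u : Vel d → ℝ) := Lp.stronglyMeasurable u
  set s : ℝ := Real.sqrt (Real.exp (2 * t) - 1) with hs
  have hm2 : StronglyMeasurable
      (fun p : Vel d × Vel d => (u : Vel d → ℝ) (Real.exp t • p.1 - s • p.2)) :=
    hu.comp_measurable (by fun_prop)
  have hm : StronglyMeasurable (semigroupFun t (u : Vel d → ℝ)) :=
    hm2.integral_prod_right (ν := stdGaussian (Vel d))
  refine ⟨hm.aestronglyMeasurable, ?_⟩
  rw [eLpNorm_lt_top_iff_lintegral_rpow_enorm_lt_top (by norm_num) (by norm_num)]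
  obtain ⟨C, hC, hCF⟩ := lintegral_affine (d := d) (Real.exp t) (Real.exp_pos t).ne'
  have hpt : ∀ v : Vel d, ‖semigroupFun t (u : Vel d → ℝ) v‖ₑ ^ (2 : ℝ≥0∞).toReal ≤
      ∫⁻ z, ‖(u : Vel d → ℝ) (Real.exp t • v - s • z)‖ₑ ^ (2 : ℝ≥0∞).toReal
        ∂(stdGaussian (Vel d)) := by
    intro v
    have hmz : AEStronglyMeasurable (fun z => (u : Vel d → ℝ) (Real.exp t • v - s • z))
        (stdGaussian (Vel d)) :=
      (hu.comp_measurable (by fun_prop)).aestronglyMeasurable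
    have h1 : ‖semigroupFun t (u : Vel d → ℝ) v‖ₑ ≤
        eLpNorm (fun z => (u : Vel d → ℝ) (Real.exp t • v - s • z)) 2 (stdGaussian (Vel d)) := by
      refine (enorm_integral_le_lintegral_enorm _).trans ?_
      rw [← eLpNorm_one_eq_lintegral_enorm]
      exact eLpNorm_le_eLpNorm_of_exponent_le (by norm_num) hmz
    refine (ENNReal.rpow_le_rpow h1 (by norm_num)).trans (le_of_eq ?_)
    rw [eLpNorm_eq_lintegral_rpow_enorm_toReal (by norm_num) (by norm_num), ← ENNReal.rpow_mul]
    norm_num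
  have hF : Measurable (fun v : Vel d => ‖(u : Vel d → ℝ) v‖ₑ ^ (2 : ℝ≥0∞).toReal) :=
    hu.measurable.enorm.pow_const _
  have hfin : ∫⁻ v, ‖(u : Vel d → ℝ) v‖ₑ ^ (2 : ℝ≥0∞).toReal < ⊤ :=
    (eLpNorm_lt_top_iff_lintegral_rpow_enorm_lt_top (by norm_num) (by norm_num)).1
      (Lp.eLpNorm_lt_top u)
  refine (lintegral_mono hpt).trans_lt ?_
  rw [lintegral_lintegral_swap]
  · have : ∀ z : Vel d,
        ∫⁻ v, ‖(u : Vel d → ℝ) (Real.exp t • v - s • z)‖ₑ ^ (2 : ℝ≥0∞).toReal =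
          C * ∫⁻ v, ‖(u : Vel d → ℝ) v‖ₑ ^ (2 : ℝ≥0∞).toReal := by
      intro z
      have := hCF _ hF (-(s • z))
      simpa only [sub_eq_add_neg] using this
    simp only [this, lintegral_const, measure_univ, mul_one]
    exact ENNReal.mul_lt_top hC.lt_top hfin
  · exact (hm2.measurable.enorm.pow_const _).aemeasurable

/-- The semigroup `P_t` with generator `Δ + v · ∇`, acting on `L²(ℝ^d)`. -/
noncomputable def semigroup {d : ℕ} (t : ℝ) (u : L2 d) : L2 d :=
  (memLp_semigroupFun t u).toLp _

/-! ### The truncated coagulation operator -/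

/-- The gain produced by particles of mass `n` and velocity `w'` merging with particles of mass `k`
and velocity `w` into particles of mass `m = n + k` and velocity `v`, so that `n w' + k w = m v`,
that is `w' = (m v - k w) / n`:
`χ_R(v) ∫ g(w') h(w) |v - w| (m / n)^q χ_R(w) dw`. -/
noncomputable def gainFun {d : ℕ} (R : ℝ) (q n k : ℕ) (g h : Vel d → ℝ) (v : Vel d) : ℝ :=
  cutoff R v * ∫ w, g ((n : ℝ)⁻¹ • (((n + k : ℕ) : ℝ) • v - (k : ℝ) • w)) * h w * ‖v - w‖ *
    (((n + k : ℕ) : ℝ) / (n : ℝ)) ^ q * cutoff R w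

/-- The loss of particles with density `g` by coagulation with particles with density `h`:
`χ_R(v) ∫ g(v) h(w) |v - w| χ_R(w) dw`. -/
noncomputable def lossFun {d : ℕ} (R : ℝ) (g h : Vel d → ℝ) (v : Vel d) : ℝ :=
  cutoff R v * ∫ w, g v * h w * ‖v - w‖ * cutoff R w

theorem stronglyMeasurable_cutoff {d : ℕ} (R : ℝ) :
    StronglyMeasurable (cutoff R : Vel d → ℝ) :=
  stronglyMeasurable_const.indicator Metric.isOpen_ball.measurableSet

theorem abs_cutoff_le {d : ℕ} (R : ℝ) (v : Vel d) : |cutoff R v| ≤ 1 := by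
  unfold cutoff
  by_cases h : v ∈ Metric.ball (0 : Vel d) R <;> simp [h]

theorem memLp_cutoff {d : ℕ} (R : ℝ) : MemLp (cutoff R : Vel d → ℝ) 2 volume :=
  memLp_indicator_const 2 Metric.isOpen_ball.measurableSet 1
    (Or.inr measure_ball_lt_top.ne)

theorem abs_cutoff_mul_dist_le {d : ℕ} (R : ℝ) (v w : Vel d) :
    |cutoff R v| * (‖v - w‖ * |cutoff R w|) ≤ 2 * |R| := by
  unfold cutoff
  by_cases hv : v ∈ Metric.ball (0 : Vel d) R
  · by_cases hw : w ∈ Metric.ball (0 : Vel d) R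
    · have h1 : ‖v‖ < R := by simpa using hv
      have h2 : ‖w‖ < R := by simpa using hw
      have h3 := norm_sub_le v w
      have h4 := le_abs_self R
      simp [hv, hw]
      linarith
    · simp [hw]
  · simp [hv]

theorem memLp_gainFun {d : ℕ} (R : ℝ) (q n k : ℕ) (hn : n ≠ 0) (hk : k ≠ 0) (g h : L2 d) :
    MemLp (gainFun R q n k (g : Vel d → ℝ) (h : Vel d → ℝ)) 2 volume := by
  have hg : StronglyMeasurable (g : Vel d → ℝ) := Lp.stronglyMeasurable g
  have hh : StronglyMeasurable (h : Vel d → ℝ) := Lp.stronglyMeasurable h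
  have hcut := stronglyMeasurable_cutoff (d := d) R
  have hn0 : (n : ℝ) ≠ 0 := Nat.cast_ne_zero.2 hn
  have hk0 : (k : ℝ) ≠ 0 := Nat.cast_ne_zero.2 hk
  set c : ℝ := (((n + k : ℕ) : ℝ) / (n : ℝ)) ^ q with hc
  have hm2 : StronglyMeasurable (fun p : Vel d × Vel d =>
      (g : Vel d → ℝ) ((n : ℝ)⁻¹ • (((n + k : ℕ) : ℝ) • p.1 - (k : ℝ) • p.2)) *
        (h : Vel d → ℝ) p.2 * ‖p.1 - p.2‖ * c * cutoff R p.2) :=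
    (((((hg.comp_measurable (by fun_prop)).mul (hh.comp_measurable measurable_snd)).mul
      (Measurable.stronglyMeasurable (by fun_prop))).mul stronglyMeasurable_const).mul
        (hcut.comp_measurable measurable_snd))
  have hm : StronglyMeasurable (gainFun R q n k (g : Vel d → ℝ) (h : Vel d → ℝ)) :=
    hcut.mul (hm2.integral_prod_right (ν := (volume : Measure (Vel d))))
  have ha : -((n : ℝ)⁻¹ * (k : ℝ)) ≠ 0 := neg_ne_zero.2 (mul_ne_zero (inv_ne_zero hn0) hk0)
  obtain ⟨C, hC, hCF⟩ := lintegral_affine (d := d) _ ha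
  set A : ℝ≥0∞ := ∫⁻ w, ‖(g : Vel d → ℝ) w‖ₑ ^ (2 : ℝ) with hA
  set B : ℝ≥0∞ := ∫⁻ w, ‖(h : Vel d → ℝ) w‖ₑ ^ (2 : ℝ) with hB
  have hAt : A < ⊤ := by
    have := (eLpNorm_lt_top_iff_lintegral_rpow_enorm_lt_top (by norm_num) (by norm_num)).1
      (Lp.eLpNorm_lt_top g)
    simpa [hA] using this
  have hBt : B < ⊤ := by
    have := (eLpNorm_lt_top_iff_lintegral_rpow_enorm_lt_top (by norm_num) (by norm_num)).1
      (Lp.eLpNorm_lt_top h)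
    simpa [hB] using this
  set D : ℝ≥0∞ := ENNReal.ofReal (2 * |R| * |c|) * ((C * A) ^ (1 / (2 : ℝ)) * B ^ (1 / (2 : ℝ)))
    with hD
  have hDt : D ≠ ⊤ := by
    refine ENNReal.mul_ne_top ENNReal.ofReal_ne_top (ENNReal.mul_ne_top ?_ ?_)
    · exact ENNReal.rpow_ne_top_of_nonneg (by norm_num) (ENNReal.mul_ne_top hC hAt.ne)
    · exact ENNReal.rpow_ne_top_of_nonneg (by norm_num) hBt.ne
  have hbd : ∀ v, ‖gainFun R q n k (g : Vel d → ℝ) (h : Vel d → ℝ) v‖ₑ ≤ D := by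
    intro v
    have hcs := ENNReal.lintegral_mul_le_Lp_mul_Lq (volume : Measure (Vel d))
      (Real.HolderConjugate.two_two)
      (f := fun w => ‖(g : Vel d → ℝ) ((n : ℝ)⁻¹ • (((n + k : ℕ) : ℝ) • v - (k : ℝ) • w))‖ₑ)
      (g := fun w => ‖(h : Vel d → ℝ) w‖ₑ)
      (hg.comp_measurable (by fun_prop)).measurable.enorm.aemeasurable
      hh.measurable.enorm.aemeasurable
    have haff : ∫⁻ w, ‖(g : Vel d → ℝ)
        ((n : ℝ)⁻¹ • (((n + k : ℕ) : ℝ) • v - (k : ℝ) • w))‖ₑ ^ (2 : ℝ) = C * A := by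
      have := hCF (fun w => ‖(g : Vel d → ℝ) w‖ₑ ^ (2 : ℝ)) (hg.measurable.enorm.pow_const _)
        ((n : ℝ)⁻¹ • ((n + k : ℕ) : ℝ) • v)
      rw [← this]
      refine lintegral_congr fun w => ?_
      congr 4
      module
    rw [haff] at hcs
    have hstep : ‖gainFun R q n k (g : Vel d → ℝ) (h : Vel d → ℝ) v‖ₑ ≤
        ∫⁻ w, ENNReal.ofReal (2 * |R| * |c|) *
          (‖(g : Vel d → ℝ) ((n : ℝ)⁻¹ • (((n + k : ℕ) : ℝ) • v - (k : ℝ) • w))‖ₑ *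
            ‖(h : Vel d → ℝ) w‖ₑ) := by
      unfold gainFun
      rw [← integral_const_mul]
      refine (enorm_integral_le_lintegral_enorm _).trans (lintegral_mono fun w => ?_)
      rw [← enorm_mul, Real.enorm_eq_ofReal_abs, Real.enorm_eq_ofReal_abs,
        ← ENNReal.ofReal_mul (by positivity)]
      refine ENNReal.ofReal_le_ofReal ?_
      have h1 := abs_cutoff_mul_dist_le R v w
      simp only [abs_mul, abs_norm]
      calc _ = |cutoff R v| * (‖v - w‖ * |cutoff R w|) * (|c| *
            (|(g : Vel d → ℝ) ((n : ℝ)⁻¹ • (((n + k : ℕ) : ℝ) • v - (k : ℝ) • w))| *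
              |(h : Vel d → ℝ) w|)) := by ring
        _ ≤ 2 * |R| * (|c| *
            (|(g : Vel d → ℝ) ((n : ℝ)⁻¹ • (((n + k : ℕ) : ℝ) • v - (k : ℝ) • w))| *
              |(h : Vel d → ℝ) w|)) := by gcongr
        _ = _ := by ring
    refine hstep.trans ?_
    rw [lintegral_const_mul' _ _ ENNReal.ofReal_ne_top]
    exact mul_le_mul_right hcs _
  refine ((memLp_cutoff (d := d) R).const_mul D.toReal).mono hm.aestronglyMeasurable
    (Filter.Eventually.of_forall fun v => ?_)
  by_cases hv : v ∈ Metric.ball (0 : Vel d) R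
  · have h1 : cutoff R v = 1 := by simp [cutoff, hv]
    have h2 := ENNReal.toReal_mono hDt (hbd v)
    rw [toReal_enorm] at h2
    simpa [h1, abs_of_nonneg ENNReal.toReal_nonneg] using h2
  · have h1 : cutoff R v = 0 := by simp [cutoff, hv]
    simp [gainFun, h1]

theorem memLp_lossFun {d : ℕ} (R : ℝ) (g h : L2 d) :
    MemLp (lossFun R (g : Vel d → ℝ) (h : Vel d → ℝ)) 2 volume := by
  have hg : StronglyMeasurable (g : Vel d → ℝ) := Lp.stronglyMeasurable g
  have hh : StronglyMeasurable (h : Vel d → ℝ) := Lp.stronglyMeasurable h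
  have hcut := stronglyMeasurable_cutoff (d := d) R
  have hm2 : StronglyMeasurable (fun p : Vel d × Vel d =>
      (g : Vel d → ℝ) p.1 * (h : Vel d → ℝ) p.2 * ‖p.1 - p.2‖ * cutoff R p.2) :=
    (((hg.comp_measurable measurable_fst).mul (hh.comp_measurable measurable_snd)).mul
      (Measurable.stronglyMeasurable (by fun_prop))).mul (hcut.comp_measurable measurable_snd)
  have hm : StronglyMeasurable (lossFun R (g : Vel d → ℝ) (h : Vel d → ℝ)) :=
    hcut.mul (hm2.integral_prod_right (ν := (volume : Measure (Vel d))))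
  have hint : Integrable (fun w => |(h : Vel d → ℝ) w| * |cutoff R w|) volume :=
    (Lp.memLp h).abs.integrable_mul (memLp_cutoff (d := d) R).abs
  set K : ℝ := 2 * |R| * ∫ w, |(h : Vel d → ℝ) w| * |cutoff R w| with hK
  refine ((Lp.memLp g).const_mul K).mono hm.aestronglyMeasurable
    (Filter.Eventually.of_forall fun v => ?_)
  have hK0 : 0 ≤ K := mul_nonneg (by positivity) (integral_nonneg fun w => by positivity)
  unfold lossFun
  rw [← integral_const_mul]
  have hstep : ‖∫ w, cutoff R v *
      ((g : Vel d → ℝ) v * (h : Vel d → ℝ) w * ‖v - w‖ * cutoff R w)‖ ≤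
      ∫ w, (2 * |R| * |(g : Vel d → ℝ) v|) * (|(h : Vel d → ℝ) w| * |cutoff R w|) := by
    refine norm_integral_le_of_norm_le (hint.const_mul _) (Filter.Eventually.of_forall fun w => ?_)
    have h1 := abs_cutoff_mul_dist_le R v w
    have h2 : |cutoff R w| = |cutoff R w| * |cutoff R w| := by
      by_cases hw : w ∈ Metric.ball (0 : Vel d) R <;> simp [cutoff, hw]
    simp only [Real.norm_eq_abs, abs_mul, abs_norm]
    rw [h2]
    calc _ = |cutoff R v| * (‖v - w‖ * |cutoff R w|) * (|(g : Vel d → ℝ) v| *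
          (|(h : Vel d → ℝ) w| * |cutoff R w|)) := by ring
      _ ≤ 2 * |R| * (|(g : Vel d → ℝ) v| * (|(h : Vel d → ℝ) w| * |cutoff R w|)) := by gcongr
      _ = (2 * |R| * |(g : Vel d → ℝ) v|) * (|(h : Vel d → ℝ) w| * |cutoff R w|) := by ring
      _ = _ := by rw [← h2]
  refine hstep.trans (le_of_eq ?_)
  rw [integral_const_mul, norm_mul, Real.norm_eq_abs, Real.norm_eq_abs, abs_of_nonneg hK0, hK]
  ring

/-- The gain term as an element of `L²(ℝ^d)`. -/
noncomputable def gain {M d : ℕ} (R : ℝ) (q : ℕ) (n k : Fin M) (g h : L2 d) : L2 d :=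
  (memLp_gainFun R q (mass n) (mass k) (Nat.succ_ne_zero _) (Nat.succ_ne_zero _) g h).toLp _

/-- The loss term as an element of `L²(ℝ^d)`. -/
noncomputable def loss {d : ℕ} (R : ℝ) (g h : L2 d) : L2 d :=
  (memLp_lossFun R g h).toLp _

/-- The truncated coagulation operator
`Q^R_m(f, f) = ∑_{n + k = m} gain_{n,k}(f_n, f_k) - 2 ∑_{n = 1}^M loss(f_m, f_n)`. -/
noncomputable def Q {M d : ℕ} (R : ℝ) (q : ℕ) (f : State M d) : State M d := fun m =>
  (∑ n : Fin M, ∑ k : Fin M, if mass n + mass k = mass m then gain R q n k (f n) (f k) else 0)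
    - (2 : ℝ) • ∑ n : Fin M, loss R (f m) (f n)

/-! ### Mild solutions -/

/-- `f` is an `L²`-mild solution on `[0, T]` of the truncated problem with initial value `f0`:
`f ∈ C([0, T], L²_M)` and
`f(t) = P_t f0 + ∫_0^t P_{t-s} (d f(s) + Q^R(f(s), f(s))) ds` for `t ∈ [0, T]`, with the integral
taken in `L²(ℝ^d)`. Only the values of `f` on `[0, T]` matter. -/
def IsMildSolution {M d : ℕ} (R : ℝ) (q : ℕ) (f0 : State M d) (T : ℝ) (f : ℝ → State M d) :
    Prop :=
  ContinuousOn f (Set.Icc 0 T) ∧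
    ∀ t ∈ Set.Icc (0 : ℝ) T, ∀ m : Fin M,
      f t m = semigroup t (f0 m) +
        ∫ s in (0 : ℝ)..t, semigroup (t - s) ((d : ℝ) • f s m + Q R q (f s) m)

/-- `f` is a maximal `L²`-mild solution, with maximal interval `[0, Tmax)`: it is a mild solution on
`[0, T]` for every `0 < T < Tmax`, and no mild solution on an interval `[0, T]` with `T ≥ Tmax`
agrees with it on `[0, Tmax)`. -/
def IsMaximalMildSolution {M d : ℕ} (R : ℝ) (q : ℕ) (f0 : State M d) (Tmax : ℝ≥0∞)
    (f : ℝ → State M d) : Prop :=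
  0 < Tmax ∧
    (∀ T : ℝ, 0 < T → ENNReal.ofReal T < Tmax → IsMildSolution R q f0 T f) ∧
    ∀ T : ℝ, 0 < T → Tmax ≤ ENNReal.ofReal T → ¬ ∃ g : ℝ → State M d,
      IsMildSolution R q f0 T g ∧ ∀ t : ℝ, 0 ≤ t → ENNReal.ofReal t < Tmax → g t = f t

end Smoluchowski

namespace Smoluchowski

/-! ### Evolution equations in Banach spaces -/

/-! On `L²_M` the coagulation operator is a bounded quadratic map: the two cutoffs bound the kernel
`|v - w|` by `2R`, and Cauchy–Schwarz in `w` controls what remains. Since `P_t` is a contraction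
semigroup, the only obstacle to global existence is a norm bound on bounded time intervals.

The bound rests on sign and on the ordering of the masses. For nonnegative densities the loss term
is nonnegative, so dropping it leaves an upper bound for `f_m`, and the `L²` norm is monotone on
nonnegative functions. The gain of mass `m` involves strictly smaller masses only. Once these are
bounded, the inequality for `‖f_m‖` is linear and Grönwall closes it; induction on the mass gives
all components (`exists_bound_truncated_solution`).

Nonnegativity is built into the construction. The loss of `f_m` is `f_m` times a bounded rate, so on
bounded nonnegative states adding `κ f` with `κ` large makes the right-hand side nonnegative. In the
Duhamel formula with damping `e^{-κt}` every operation then preserves the cone, and so do the Picard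
iterates (`exists_mild_solution_mem_cone`, `duhamel_unshift`).

To make the nonlinearity globally Lipschitz, the arguments of `Q` are retracted radially to norm
`N`. The a priori bound does not depend on `N`, so for `N` large the retraction is never active and
a true solution exists on each `[0, T]` (`exists_isMildSolution`), with no continuation argument.
Uniqueness (`IsMildSolution.eqOn`) glues these solutions and excludes a finite maximal interval. -/

/-- Grönwall's inequality in integral form. -/
theorem le_of_le_add_integral {T a b : ℝ} (hb : 0 ≤ b) {u : ℝ → ℝ}
    (hu : ContinuousOn u (Set.Icc 0 T))
    (h : ∀ t ∈ Set.Icc 0 T, u t ≤ a + b * ∫ s in (0 : ℝ)..t, u s) :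
    ∀ t ∈ Set.Icc 0 T, u t ≤ a * Real.exp (b * t) := by
  intro t ht
  have hT : 0 ≤ T := ht.1.trans ht.2
  have hint : ∀ x ∈ Set.Icc 0 T, IntervalIntegrable u volume 0 x := fun x hx =>
    (hu.mono (by rw [Set.uIcc_of_le hx.1]; exact Set.Icc_subset_Icc_right hx.2)).intervalIntegrable
  have hcont : ContinuousOn (fun x => ∫ s in (0 : ℝ)..x, u s) (Set.Icc 0 T) := by
    have := intervalIntegral.continuousOn_primitive_interval (f := u) (μ := volume) (a := 0) (b := T)
      (by rw [Set.uIcc_of_le hT]; exact hu.integrableOn_Icc)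
    rwa [Set.uIcc_of_le hT] at this
  -- The differential Grönwall inequality is applied to the majorant `a + b ∫ u`, not to `u`: its
  -- right derivative `b u` is at most `b` times the majorant.
  have key := le_gronwallBound_of_liminf_deriv_right_le (f := fun x => a + b * ∫ s in (0 : ℝ)..x, u s)
    (f' := fun x => b * u x) (δ := a) (K := b) (ε := 0) (a := 0) (b := T)
    (by fun_prop) ?_ (by simp) ?_ t ht
  · rw [gronwallBound_ε0, sub_zero] at key
    exact (h t ht).trans key
  · intro x hx r hr
    have hd : HasDerivWithinAt (fun x => a + b * ∫ s in (0 : ℝ)..x, u s) (b * u x) (Set.Ici x) x := by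
      have h1 : HasDerivWithinAt (fun x => ∫ s in (0 : ℝ)..x, u s) (u x) (Set.Ici x) x := by
        have hx' : Set.Icc x T ∈ nhdsWithin x (Set.Ici x) := Icc_mem_nhdsGE hx.2
        have hcx : ContinuousWithinAt u (Set.Ici x) x :=
          ((hu x ⟨hx.1, hx.2.le⟩).mono (Set.Icc_subset_Icc_left hx.1)).mono_of_mem_nhdsWithin hx'
        refine intervalIntegral.integral_hasDerivWithinAt_right (hint x ⟨hx.1, hx.2.le⟩)
          (s := Set.Ici x) (t := Set.Ioi x) ?_ (hcx.mono Set.Ioi_subset_Ici_self)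
        refine ⟨Set.Icc x T, nhdsWithin_mono x Set.Ioi_subset_Ici_self hx', ?_⟩
        exact (hu.mono (Set.Icc_subset_Icc_left hx.1)).aestronglyMeasurable measurableSet_Icc
      exact (h1.const_mul b).const_add a
    exact hd.liminf_right_slope_le hr
  · intro x hx
    rw [add_zero]
    exact mul_le_mul_of_nonneg_left (h x ⟨hx.1, hx.2.le⟩) hb

/-! ### Duhamel formulas, Picard iteration and invariant cones -/

section Evolution

variable {X : Type*} [NormedAddCommGroup X] [NormedSpace ℝ X]

/-- The bound is uniform in `t`, so a Lipschitz constant below `κ` gives a contraction on intervals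
of any length, without small times. -/
theorem integral_exp_neg_mul_sub_le {κ t : ℝ} (hκ : 0 < κ) :
    ∫ s in (0 : ℝ)..t, Real.exp (-κ * (t - s)) ≤ κ⁻¹ := by
  have h : ∀ s ∈ Set.uIcc 0 t, HasDerivAt (fun s => κ⁻¹ * Real.exp (-κ * (t - s)))
      (Real.exp (-κ * (t - s))) s := by
    intro s _
    have := ((((hasDerivAt_id s).const_sub t).const_mul (-κ)).exp).const_mul κ⁻¹
    refine this.congr_deriv ?_
    field_simp
    simp
  rw [intervalIntegral.integral_eq_sub_of_hasDerivAt h (by apply Continuous.intervalIntegrable; fun_prop)]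
  have : 0 ≤ κ⁻¹ * Real.exp (-κ * (t - 0)) := by positivity
  simp only [sub_self, mul_zero, Real.exp_zero, mul_one]
  linarith

theorem continuousOn_clm_sub {S : ℝ → X →L[ℝ] X} (hS : Continuous fun p : ℝ × X => S p.1 p.2)
    (t : ℝ) {u : ℝ → X} {A : Set ℝ} (hu : ContinuousOn u A) :
    ContinuousOn (fun r => S (t - r) (u r)) A :=
  hS.comp_continuousOn ((by fun_prop : Continuous fun r : ℝ => t - r).continuousOn.prodMk hu)

/-- Picard iteration for the integrated form of `g' = (A - κ) g + G(t, g)`, with `A` the generator of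
a contraction semigroup `S` and `G` Lipschitz with a constant below `κ`, within an invariant set. -/
theorem exists_fixedPoint_duhamel [CompleteSpace X] (S : ℝ → X →L[ℝ] X)
    (hS : Continuous fun p : ℝ × X => S p.1 p.2) (hS1 : ∀ t, 0 ≤ t → ∀ x, ‖S t x‖ ≤ ‖x‖)
    {κ L T : ℝ} (hT : 0 ≤ T) (hL : 0 ≤ L) (hκ : L < κ) (G : ℝ → X → X)
    (hG : Continuous fun p : ℝ × X => G p.1 p.2)
    (hGL : ∀ s x y, ‖G s x - G s y‖ ≤ L * ‖x - y‖) (x₀ : X) (K : Set X) (hK : IsClosed K)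
    (hK0 : K.Nonempty)
    (hinv : ∀ h : ℝ → X, Continuous h → (∀ s, h s ∈ K) → ∀ t ∈ Set.Icc 0 T,
      Real.exp (-κ * t) • S t x₀ +
        ∫ s in (0 : ℝ)..t, Real.exp (-κ * (t - s)) • S (t - s) (G s (h s)) ∈ K) :
    ∃ g : ℝ → X, Continuous g ∧ (∀ t, g t ∈ K) ∧ ∀ t ∈ Set.Icc 0 T,
      g t = Real.exp (-κ * t) • S t x₀ +
        ∫ s in (0 : ℝ)..t, Real.exp (-κ * (t - s)) • S (t - s) (G s (g s)) := by
  have hκ0 : 0 < κ := hL.trans_lt hκ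
  have hcont : ∀ h : ℝ → X, Continuous h → Continuous fun p : ℝ × ℝ =>
      Real.exp (-κ * (p.1 - p.2)) • S (p.1 - p.2) (G p.2 (h p.2)) := by
    intro h hh
    refine Continuous.smul (by fun_prop) ?_
    exact hS.comp (Continuous.prodMk (by fun_prop)
      (hG.comp (continuous_snd.prodMk (hh.comp continuous_snd))))
  have hcont1 : ∀ h : ℝ → X, Continuous h → Continuous fun t : ℝ =>
      Real.exp (-κ * t) • S t x₀ +
        ∫ s in (0 : ℝ)..t, Real.exp (-κ * (t - s)) • S (t - s) (G s (h s)) := by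
    intro h hh
    refine Continuous.add (Continuous.smul (by fun_prop)
      (hS.comp (continuous_id.prodMk continuous_const))) ?_
    exact intervalIntegral.continuous_parametric_intervalIntegral_of_continuous
      (f := fun t s => Real.exp (-κ * (t - s)) • S (t - s) (G s (h s))) (hcont h hh) continuous_id
  -- The Banach space is `C([0, T], X)`; constant extension beyond the endpoints lets the integrands
  -- be continuous on all of `ℝ`.
  let Φ : C(Set.Icc 0 T, X) → C(Set.Icc 0 T, X) := fun h =>
    ⟨fun t => Real.exp (-κ * t) • S t x₀ + ∫ s in (0 : ℝ)..t,
        Real.exp (-κ * (t - s)) • S (t - s) (G s (Set.IccExtend hT h s)),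
      (hcont1 _ h.continuous.Icc_extend').comp continuous_subtype_val⟩
  have hΦ : ContractingWith (L / κ).toNNReal Φ := by
    refine ⟨?_, LipschitzWith.of_dist_le_mul fun h h' => ?_⟩
    · rw [Real.toNNReal_lt_one]
      exact (div_lt_one hκ0).2 hκ
    · rw [Real.coe_toNNReal _ (by positivity), ContinuousMap.dist_le (by positivity)]
      intro t
      simp only [Φ, ContinuousMap.coe_mk]
      have hi : ∀ h : C(Set.Icc 0 T, X), IntervalIntegrable (fun s =>
          Real.exp (-κ * (t - s)) • S (t - s) (G s (Set.IccExtend hT h s))) volume 0 t := fun h =>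
        ((hcont _ h.continuous.Icc_extend').comp
          (by fun_prop : Continuous fun s : ℝ => ((t : ℝ), s))).intervalIntegrable _ _
      rw [dist_add_left, dist_eq_norm, ← intervalIntegral.integral_sub (hi h) (hi h')]
      calc _ ≤ ∫ s in (0 : ℝ)..t, Real.exp (-κ * (t - s)) * (L * dist h h') := by
            refine intervalIntegral.norm_integral_le_of_norm_le t.2.1 ?_
              (Continuous.intervalIntegrable (by fun_prop) _ _)
            refine Filter.Eventually.of_forall fun s hs => ?_
            rw [← smul_sub, ← map_sub, norm_smul, Real.norm_of_nonneg (Real.exp_pos _).le]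
            refine mul_le_mul_of_nonneg_left ?_ (Real.exp_pos _).le
            refine (hS1 _ (sub_nonneg.2 hs.2) _).trans ((hGL _ _ _).trans ?_)
            refine mul_le_mul_of_nonneg_left ?_ hL
            rw [← dist_eq_norm]
            exact ContinuousMap.dist_apply_le_dist _
        _ ≤ κ⁻¹ * (L * dist h h') := by
            rw [intervalIntegral.integral_mul_const]
            exact mul_le_mul_of_nonneg_right (integral_exp_neg_mul_sub_le hκ0) (by positivity)
        _ = L / κ * dist h h' := by ring
  obtain ⟨k0, hk0⟩ := hK0
  -- Starting from a constant in `K`, all iterates stay in `K`; the fixed point is their limit, and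
  -- `K` is closed.
  have hiter : ∀ n, ∀ t, (Φ^[n] (ContinuousMap.const _ k0)) t ∈ K := by
    intro n
    induction n with
    | zero => intro t; exact hk0
    | succ n ih =>
      intro t
      rw [Function.iterate_succ_apply']
      exact hinv _ (ContinuousMap.continuous _).Icc_extend' (fun s => ih _) t t.2
  have hlim := hΦ.tendsto_iterate_fixedPoint (ContinuousMap.const _ k0)
  have hfix : Φ (ContractingWith.fixedPoint Φ hΦ) = ContractingWith.fixedPoint Φ hΦ := hΦ.fixedPoint_isFixedPt
  set g := ContractingWith.fixedPoint Φ hΦ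
  refine ⟨Set.IccExtend hT g, g.continuous.Icc_extend', fun t => ?_, fun t ht => ?_⟩
  · refine hK.mem_of_tendsto ((continuous_eval_const (Set.projIcc 0 T hT t)).continuousAt.tendsto.comp hlim)
      (Filter.Eventually.of_forall fun n => hiter n _)
  · rw [Set.IccExtend_of_mem hT _ ht]
    exact (DFunLike.congr_fun hfix ⟨t, ht⟩).symm

/-- A solution of the integrated form of `f' = (A - κ) f + g` also solves that of
`f' = A f + (g - κ f)`. -/
theorem duhamel_unshift [CompleteSpace X] (S : ℝ → X →L[ℝ] X)
    (hS : Continuous fun p : ℝ × X => S p.1 p.2)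
    (hSS : ∀ s t, 0 ≤ s → 0 ≤ t → ∀ x, S s (S t x) = S (s + t) x)
    {κ T : ℝ} {f g : ℝ → X} (hf : Continuous f) (hg : Continuous g) (x₀ : X)
    (h : ∀ t ∈ Set.Icc 0 T, f t = Real.exp (-κ * t) • S t x₀ +
      ∫ s in (0 : ℝ)..t, Real.exp (-κ * (t - s)) • S (t - s) (g s)) :
    ∀ t ∈ Set.Icc 0 T, f t = S t x₀ + ∫ s in (0 : ℝ)..t, S (t - s) (g s - κ • f s) := by
  intro t ht
  have hSg : Continuous fun r => S (t - r) (g r) := hS.comp (Continuous.prodMk (by fun_prop) hg)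
  have hSf : Continuous fun r => S (t - r) (f r) := hS.comp (Continuous.prodMk (by fun_prop) hf)
  have hk : Continuous fun p : ℝ × ℝ => (κ * Real.exp (-κ * (p.1 - p.2))) • S (t - p.2) (g p.2) :=
    Continuous.smul (by fun_prop) (hSg.comp continuous_snd)
  have hexp : ∀ r x : ℝ, ∫ s in r..x, κ * Real.exp (-κ * (s - r)) = 1 - Real.exp (-κ * (x - r)) := by
    intro r x
    have hd : ∀ s ∈ Set.uIcc r x, HasDerivAt (fun s => -Real.exp (-κ * (s - r)))
        (κ * Real.exp (-κ * (s - r))) s := by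
      intro s _
      have := ((((hasDerivAt_id s).sub_const r).const_mul (-κ)).exp).neg
      refine this.congr_deriv ?_
      simp [mul_comm]
    rw [intervalIntegral.integral_eq_sub_of_hasDerivAt hd
      (by apply Continuous.intervalIntegrable; fun_prop)]
    simp
    ring
  -- The formula for `f s` is substituted into `κ S(t - s) f(s)`; the semigroup law collapses `S(t -
  -- s) S(s - r)` to `S(t - r)`, so `s` survives only in a scalar factor.
  have h1 : ∀ s ∈ Set.uIcc 0 t, κ • S (t - s) (f s) = (κ * Real.exp (-κ * (s - 0))) • S t x₀ +
      ∫ r in (0 : ℝ)..s, (κ * Real.exp (-κ * (s - r))) • S (t - r) (g r) := by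
    intro s hs
    rw [Set.uIcc_of_le ht.1] at hs
    have hint : IntervalIntegrable (fun r => Real.exp (-κ * (s - r)) • S (s - r) (g r)) volume 0 s := by
      apply Continuous.intervalIntegrable
      exact Continuous.smul (by fun_prop) (hS.comp (Continuous.prodMk (by fun_prop) hg))
    rw [h s ⟨hs.1, hs.2.trans ht.2⟩, map_add, ← ContinuousLinearMap.intervalIntegral_comp_comm _ hint,
      map_smul, hSS _ _ (sub_nonneg.2 hs.2) hs.1, smul_add, smul_smul, ← intervalIntegral.integral_smul,
      sub_add_cancel, sub_zero]
    congr 1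
    refine intervalIntegral.integral_congr fun r hr => ?_
    rw [Set.uIcc_of_le hs.1] at hr
    simp only [map_smul]
    rw [hSS _ _ (sub_nonneg.2 hs.2) (sub_nonneg.2 hr.2), smul_smul, sub_add_sub_cancel]
  -- Fubini on the triangle `r ≤ s`.
  have h2 : ∫ s in (0 : ℝ)..t, ∫ r in (0 : ℝ)..s, (κ * Real.exp (-κ * (s - r))) • S (t - r) (g r) =
      ∫ r in (0 : ℝ)..t, ∫ s in r..t, (κ * Real.exp (-κ * (s - r))) • S (t - r) (g r) := by
    set D : Set (ℝ × ℝ) := {p | p.2 ≤ p.1} with hD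
    have hDm : MeasurableSet D := measurableSet_le measurable_snd measurable_fst
    set φ : ℝ × ℝ → X := D.indicator fun p => (κ * Real.exp (-κ * (p.1 - p.2))) • S (t - p.2) (g p.2)
      with hφ
    have hφi : Integrable φ ((volume.restrict (Set.Ioc 0 t)).prod (volume.restrict (Set.Ioc 0 t))) := by
      refine Integrable.indicator ?_ hDm
      rw [Measure.prod_restrict]
      exact (hk.continuousOn.integrableOn_compact (isCompact_Icc.prod isCompact_Icc)).mono_set
        (Set.prod_mono Set.Ioc_subset_Icc_self Set.Ioc_subset_Icc_self)
    have hsw := integral_integral_swap (f := fun s r => φ (s, r)) hφi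
    rw [intervalIntegral.integral_of_le ht.1, intervalIntegral.integral_of_le ht.1]
    refine Eq.trans ?_ (hsw.trans ?_)
    · refine setIntegral_congr_fun measurableSet_Ioc fun s hs => ?_
      rw [intervalIntegral.integral_of_le hs.1.le]
      have : (fun r => φ (s, r)) = (Set.Iic s).indicator
          fun r => (κ * Real.exp (-κ * (s - r))) • S (t - r) (g r) := by
        ext r; simp [hφ, hD, Set.indicator_apply]
      rw [this, integral_indicator measurableSet_Iic, Measure.restrict_restrict measurableSet_Iic]
      congr 2
      ext r
      simp only [Set.mem_Ioc, Set.mem_inter_iff, Set.mem_Iic]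
      constructor
      · rintro ⟨a, b⟩; exact ⟨b, a, b.trans hs.2⟩
      · rintro ⟨a, b, c⟩; exact ⟨b, a⟩
    · refine setIntegral_congr_fun measurableSet_Ioc fun r hr => ?_
      rw [intervalIntegral.integral_of_le hr.2, ← integral_Icc_eq_integral_Ioc (x := r)]
      have : (fun s => φ (s, r)) = (Set.Ici r).indicator
          fun s => (κ * Real.exp (-κ * (s - r))) • S (t - r) (g r) := by
        ext s; simp [hφ, hD, Set.indicator_apply]
      rw [this, integral_indicator measurableSet_Ici, Measure.restrict_restrict measurableSet_Ici]
      congr 2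
      ext s
      simp only [Set.mem_Ioc, Set.mem_inter_iff, Set.mem_Ici, Set.mem_Icc]
      constructor
      · rintro ⟨a, b, c⟩; exact ⟨a, c⟩
      · rintro ⟨a, c⟩; exact ⟨a, hr.1.trans_le a, c⟩
  -- After the swap the scalar factor integrates to `1 - e^{-κ(t - r)}`; its two parts convert the
  -- damped formula into the undamped one.
  have h3 : ∫ s in (0 : ℝ)..t, κ • S (t - s) (f s) = (1 - Real.exp (-κ * t)) • S t x₀ +
      ∫ r in (0 : ℝ)..t, (1 - Real.exp (-κ * (t - r))) • S (t - r) (g r) := by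
    rw [intervalIntegral.integral_congr h1, intervalIntegral.integral_add, h2,
      intervalIntegral.integral_smul_const, hexp, sub_zero]
    · simp only [intervalIntegral.integral_smul_const, hexp]
    · apply Continuous.intervalIntegrable
      fun_prop
    · apply Continuous.intervalIntegrable
      exact intervalIntegral.continuous_parametric_intervalIntegral_of_continuous
        (f := fun s r => (κ * Real.exp (-κ * (s - r))) • S (t - r) (g r)) hk continuous_id
  simp only [map_sub, map_smul]
  have h5 : IntervalIntegrable (fun r => κ • S (t - r) (f r)) volume 0 t :=
    (hSf.const_smul κ).intervalIntegrable _ _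
  rw [intervalIntegral.integral_sub (hSg.intervalIntegrable _ _) h5, h3, h t ht]
  have h4 : ∫ r in (0 : ℝ)..t, (1 - Real.exp (-κ * (t - r))) • S (t - r) (g r) =
      (∫ r in (0 : ℝ)..t, S (t - r) (g r)) -
        ∫ r in (0 : ℝ)..t, Real.exp (-κ * (t - r)) • S (t - r) (g r) := by
    simp only [sub_smul, one_smul]
    refine intervalIntegral.integral_sub (hSg.intervalIntegrable _ _) (Continuous.intervalIntegrable ?_ _ _)
    exact Continuous.smul (by fun_prop) hSg
  rw [h4]
  module

/-- The mild form of `f' = A f + F(f)`, with `A` the generator of a contraction semigroup `S` and `F`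
Lipschitz, has a solution in a closed convex cone that is invariant under `S` and `F + κ`. -/
theorem exists_mild_solution_mem_cone [CompleteSpace X] (S : ℝ → X →L[ℝ] X)
    (hS : Continuous fun p : ℝ × X => S p.1 p.2) (hS1 : ∀ t, 0 ≤ t → ∀ x, ‖S t x‖ ≤ ‖x‖)
    (hSS : ∀ s t, 0 ≤ s → 0 ≤ t → ∀ x, S s (S t x) = S (s + t) x)
    {κ L T : ℝ} (hT : 0 ≤ T) (hL : 0 ≤ L) (hκ : 0 ≤ κ) (F : X → X)
    (hF : ∀ x y, ‖F x - F y‖ ≤ L * ‖x - y‖) (K : Set X) (hK : IsClosed K)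
    (hKadd : ∀ x ∈ K, ∀ y ∈ K, x + y ∈ K) (hKsmul : ∀ c : ℝ, 0 ≤ c → ∀ x ∈ K, c • x ∈ K)
    (hKint : ∀ (u : ℝ → X) (t : ℝ), 0 ≤ t → Continuous u → (∀ s, u s ∈ K) →
      ∫ s in (0 : ℝ)..t, u s ∈ K)
    (hKS : ∀ t, ∀ x ∈ K, S t x ∈ K) (hKF : ∀ x ∈ K, F x + κ • x ∈ K) {x₀ : X} (hx₀ : x₀ ∈ K) :
    ∃ f : ℝ → X, Continuous f ∧ (∀ t, f t ∈ K) ∧ ∀ t ∈ Set.Icc 0 T,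
      f t = S t x₀ + ∫ s in (0 : ℝ)..t, S (t - s) (F (f s)) := by
  set H : X → X := fun x => F x + κ • x with hH
  have hHL : ∀ x y, ‖H x - H y‖ ≤ (L + κ) * ‖x - y‖ := by
    intro x y
    have : H x - H y = (F x - F y) + κ • (x - y) := by
      simp only [hH]
      module
    rw [this, add_mul]
    refine (norm_add_le _ _).trans (add_le_add (hF x y) ?_)
    rw [norm_smul, Real.norm_of_nonneg hκ]
  have hHc : Continuous H :=
    (LipschitzWith.of_dist_le_mul (K := (L + κ).toNNReal) fun x y => by
      rw [dist_eq_norm, dist_eq_norm, Real.coe_toNNReal _ (by positivity)]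
      exact hHL x y).continuous
  -- `H = F + κ` has Lipschitz constant `L + κ`, which the damping `κ` alone does not beat. Passing
  -- to `g = e^{-μt} f` raises the damping to `κ + μ > L + κ` and leaves the Lipschitz constant
  -- unchanged.
  set μ : ℝ := L + 1 with hμ
  have hcG : Continuous fun p : ℝ × X => Real.exp (-μ * p.1) • H (Real.exp (μ * p.1) • p.2) := by
    fun_prop
  have hGL : ∀ (s : ℝ) (x y : X), ‖Real.exp (-μ * s) • H (Real.exp (μ * s) • x) -
      Real.exp (-μ * s) • H (Real.exp (μ * s) • y)‖ ≤ (L + κ) * ‖x - y‖ := by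
    intro s x y
    rw [← smul_sub, norm_smul, Real.norm_of_nonneg (Real.exp_pos _).le]
    calc _ ≤ Real.exp (-μ * s) * ((L + κ) * ‖Real.exp (μ * s) • x - Real.exp (μ * s) • y‖) :=
          mul_le_mul_of_nonneg_left (hHL _ _) (Real.exp_pos _).le
      _ = (Real.exp (-μ * s) * Real.exp (μ * s)) * ((L + κ) * ‖x - y‖) := by
          rw [← smul_sub, norm_smul, Real.norm_of_nonneg (Real.exp_pos _).le]
          ring
      _ = _ := by
          rw [← Real.exp_add]
          simp
  obtain ⟨g, hgc, hgK, hg⟩ := exists_fixedPoint_duhamel S hS hS1 (κ := κ + μ) (L := L + κ)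
    hT (by positivity) (by linarith) (fun s x => Real.exp (-μ * s) • H (Real.exp (μ * s) • x))
    hcG hGL x₀ K hK ⟨x₀, hx₀⟩ (by
      intro h hc hh t ht
      refine hKadd _ (hKsmul _ (Real.exp_pos _).le _ (hKS t _ hx₀)) _ (hKint _ t ht.1 ?_ fun s => ?_)
      · refine Continuous.smul (by fun_prop) (hS.comp (Continuous.prodMk (by fun_prop) ?_))
        fun_prop
      · exact hKsmul _ (Real.exp_pos _).le _ (hKS _ _ (hKsmul _ (Real.exp_pos _).le _
          (hKF _ (hKsmul _ (Real.exp_pos _).le _ (hh s))))))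
  set f : ℝ → X := fun t => Real.exp (μ * t) • g t with hf
  have hfc : Continuous f := by fun_prop
  refine ⟨f, hfc, fun t => hKsmul _ (Real.exp_pos _).le _ (hgK t), ?_⟩
  have hshift : ∀ t ∈ Set.Icc 0 T, f t = Real.exp (-κ * t) • S t x₀ +
      ∫ s in (0 : ℝ)..t, Real.exp (-κ * (t - s)) • S (t - s) (H (f s)) := by
    intro t ht
    simp only [hf]
    rw [hg t ht, smul_add, smul_smul, ← Real.exp_add, ← intervalIntegral.integral_smul]
    congr 2
    · congr 1
      ring
    · funext s
      rw [map_smul, smul_smul, smul_smul, ← Real.exp_add, ← Real.exp_add]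
      congr 2
      ring
  have := duhamel_unshift S hS hSS hfc (hHc.comp hfc) x₀ hshift
  simpa [hH] using this

end Evolution

/-! ### The semigroup on `L²` -/

section L2Bounds

variable {α β E : Type*} [MeasurableSpace α] [MeasurableSpace β] [NormedAddCommGroup E]

theorem sq_eLpNorm_two (f : α → E) (μ : Measure α) :
    eLpNorm f 2 μ ^ 2 = ∫⁻ x, ‖f x‖ₑ ^ 2 ∂μ := by
  rw [eLpNorm_eq_lintegral_rpow_enorm_toReal two_ne_zero ENNReal.ofNat_ne_top,
    ← ENNReal.rpow_natCast, ← ENNReal.rpow_mul]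
  norm_num

/-- Averaging over a probability measure is a contraction in `L²`. -/
theorem eLpNorm_two_integral_le {μ : Measure α} {ν : Measure β} [SFinite μ] [IsProbabilityMeasure ν]
    {w : α × β → ℝ} (hw : AEStronglyMeasurable w (μ.prod ν)) :
    eLpNorm (fun x => ∫ y, w (x, y) ∂ν) 2 μ ≤ eLpNorm w 2 (μ.prod ν) := by
  rw [← ENNReal.pow_le_pow_left_iff two_ne_zero, sq_eLpNorm_two, sq_eLpNorm_two,
    lintegral_prod _ (hw.enorm.pow_const 2)]
  refine lintegral_mono_ae ?_
  filter_upwards [hw.prodMk_left] with x hx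
  rw [← sq_eLpNorm_two (fun y => w (x, y))]
  gcongr
  refine (enorm_integral_le_lintegral_enorm _).trans ?_
  rw [← eLpNorm_one_eq_lintegral_enorm]
  exact eLpNorm_le_eLpNorm_of_exponent_le (by norm_num) hx

end L2Bounds

/-- The affine maps `(v, z) ↦ e^t v - √(e^{2t} - 1) z` that define the semigroup. -/
noncomputable def ouMap {d : ℕ} (t : ℝ) (p : Vel d × Vel d) : Vel d :=
  Real.exp t • p.1 - Real.sqrt (Real.exp (2 * t) - 1) • p.2

theorem measurable_ouMap {d : ℕ} (t : ℝ) : Measurable (ouMap t : Vel d × Vel d → Vel d) := by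
  unfold ouMap
  fun_prop

theorem map_affine_volume {d : ℕ} {a : ℝ} (ha : a ≠ 0) (b : Vel d) :
    Measure.map (fun v => a • v + b) (volume : Measure (Vel d)) =
      ENNReal.ofReal |(a ^ d)⁻¹| • volume := by
  have h : (fun v : Vel d => a • v + b) = (fun v => v + b) ∘ (a • ·) := rfl
  rw [h, ← Measure.map_map (by fun_prop) (by fun_prop), Measure.map_addHaar_smul _ ha,
    Measure.map_smul, map_add_right_eq_self]
  simp

theorem quasiMeasurePreserving_affine {d : ℕ} {a : ℝ} (ha : a ≠ 0) (b : Vel d) :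
    Measure.QuasiMeasurePreserving (fun v : Vel d => a • v + b) volume volume := by
  refine ⟨by fun_prop, ?_⟩
  rw [map_affine_volume ha]
  exact Measure.smul_absolutelyContinuous

/-- For each fixed `z` the map is a dilation by `e^t` followed by a translation, so Lebesgue measure
scales by `e^{-dt}` independently of `z`, and averaging over a probability measure changes nothing.
-/
theorem map_ouMap {d : ℕ} (t : ℝ) :
    Measure.map (ouMap t) ((volume : Measure (Vel d)).prod (stdGaussian (Vel d))) =
      ENNReal.ofReal (Real.exp (-(d * t))) • volume := by
  ext s hs
  rw [Measure.map_apply (measurable_ouMap t) hs, Measure.prod_apply_symm (measurable_ouMap t hs)]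
  have : ∀ z : Vel d, volume ((fun v => (v, z)) ⁻¹' (ouMap t ⁻¹' s)) =
      (ENNReal.ofReal (Real.exp (-(d * t))) • (volume : Measure (Vel d))) s := by
    intro z
    have h1 := map_affine_volume (d := d) (Real.exp_pos t).ne'
      (-(Real.sqrt (Real.exp (2 * t) - 1) • z))
    have h2 : |(Real.exp t ^ d)⁻¹| = Real.exp (-(d * t)) := by
      rw [abs_of_pos (by positivity), ← Real.exp_nat_mul, ← Real.exp_neg]
    rw [← h2, ← h1, Measure.map_apply (by fun_prop) hs]
    simp only [← sub_eq_add_neg]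
    rfl
  simp [this]

theorem quasiMeasurePreserving_ouMap {d : ℕ} (t : ℝ) :
    Measure.QuasiMeasurePreserving (ouMap t)
      ((volume : Measure (Vel d)).prod (stdGaussian (Vel d))) volume := by
  refine ⟨measurable_ouMap t, ?_⟩
  rw [map_ouMap]
  exact Measure.smul_absolutelyContinuous

theorem eLpNorm_comp_ouMap {d : ℕ} (t : ℝ) {u : Vel d → ℝ} (hu : AEStronglyMeasurable u volume) :
    eLpNorm (u ∘ ouMap t) 2 ((volume : Measure (Vel d)).prod (stdGaussian (Vel d))) =
      ENNReal.ofReal (Real.exp (-(d * t) / 2)) * eLpNorm u 2 volume := by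
  have hu' : AEStronglyMeasurable u
      (Measure.map (ouMap t) ((volume : Measure (Vel d)).prod (stdGaussian (Vel d)))) := by
    rw [map_ouMap]
    exact hu.mono_ac Measure.smul_absolutelyContinuous
  rw [← eLpNorm_map_measure hu' (measurable_ouMap t).aemeasurable, map_ouMap,
    eLpNorm_smul_measure_of_ne_top ENNReal.ofNat_ne_top, smul_eq_mul,
    ENNReal.ofReal_rpow_of_pos (Real.exp_pos _), ← Real.exp_mul]
  norm_num [div_eq_mul_inv]

theorem memLp_comp_ouMap {d : ℕ} (t : ℝ) {u : Vel d → ℝ} (hu : MemLp u 2 volume) :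
    MemLp (u ∘ ouMap t) 2 ((volume : Measure (Vel d)).prod (stdGaussian (Vel d))) := by
  refine ⟨hu.1.comp_quasiMeasurePreserving (quasiMeasurePreserving_ouMap t), ?_⟩
  rw [eLpNorm_comp_ouMap t hu.1]
  exact ENNReal.mul_lt_top ENNReal.ofReal_lt_top hu.2

/-- By Fubini almost every slice is square integrable, hence integrable, as the Gaussian is finite.
This supplies the integrability that additivity of the semigroup needs. -/
theorem ae_integrable_comp_ouMap {d : ℕ} (t : ℝ) {u : Vel d → ℝ} (hu : MemLp u 2 volume) :
    ∀ᵐ v, Integrable (fun z => u (ouMap t (v, z))) (stdGaussian (Vel d)) := by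
  have h := memLp_comp_ouMap t hu
  filter_upwards [h.integrable_sq.prod_right_ae, h.1.prodMk_left] with v hv hm
  exact ((memLp_two_iff_integrable_sq hm).2 hv).integrable one_le_two

/-- Makes the pointwise formula independent of the representative, so that any convenient one may be
used below. -/
theorem semigroupFun_congr {d : ℕ} (t : ℝ) {u u' : Vel d → ℝ} (h : u =ᵐ[volume] u') :
    semigroupFun t u =ᵐ[volume] semigroupFun t u' := by
  filter_upwards [Measure.ae_ae_of_ae_prod ((quasiMeasurePreserving_ouMap t).ae h)] with v hv
  exact integral_congr_ae hv

theorem coeFn_semigroup {d : ℕ} (t : ℝ) (u : L2 d) :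
    semigroup t u =ᵐ[volume] semigroupFun t u :=
  MemLp.coeFn_toLp _

theorem semigroup_eq_of_ae {d : ℕ} (t : ℝ) (u : L2 d) {u' : Vel d → ℝ} (h : u =ᵐ[volume] u') :
    semigroup t u =ᵐ[volume] semigroupFun t u' :=
  (coeFn_semigroup t u).trans (semigroupFun_congr t h)

theorem semigroup_add {d : ℕ} (t : ℝ) (u u' : L2 d) :
    semigroup t (u + u') = semigroup t u + semigroup t u' := by
  refine Lp.ext ?_
  refine (semigroup_eq_of_ae t _ (Lp.coeFn_add u u')).trans ?_
  filter_upwards [Lp.coeFn_add (semigroup t u) (semigroup t u'), coeFn_semigroup t u,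
    coeFn_semigroup t u', ae_integrable_comp_ouMap t (Lp.memLp u),
    ae_integrable_comp_ouMap t (Lp.memLp u')] with v h h1 h2 h3 h4
  rw [h, Pi.add_apply, h1, h2]
  exact integral_add h3 h4

theorem semigroup_smul {d : ℕ} (t c : ℝ) (u : L2 d) :
    semigroup t (c • u) = c • semigroup t u := by
  refine Lp.ext ?_
  refine (semigroup_eq_of_ae t _ (Lp.coeFn_smul c u)).trans ?_
  filter_upwards [Lp.coeFn_smul c (semigroup t u), coeFn_semigroup t u] with v h h1
  rw [h, Pi.smul_apply, h1]
  exact integral_const_mul _ _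

theorem norm_semigroup_le {d : ℕ} (t : ℝ) (u : L2 d) :
    ‖semigroup t u‖ ≤ Real.exp (-(d * t) / 2) * ‖u‖ := by
  rw [semigroup, Lp.norm_toLp, Lp.norm_def]
  have h : eLpNorm (semigroupFun t (u : Vel d → ℝ)) 2 volume ≤
      ENNReal.ofReal (Real.exp (-(d * t) / 2)) * eLpNorm u 2 volume := by
    have h1 := eLpNorm_two_integral_le (memLp_comp_ouMap t (Lp.memLp u)).1
    rw [eLpNorm_comp_ouMap t (Lp.aestronglyMeasurable u)] at h1
    exact h1
  have h' := ENNReal.toReal_mono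
    (ENNReal.mul_ne_top ENNReal.ofReal_ne_top (Lp.eLpNorm_ne_top u)) h
  rwa [ENNReal.toReal_mul, ENNReal.toReal_ofReal (Real.exp_pos _).le] at h'

theorem semigroup_nonneg {d : ℕ} (t : ℝ) {u : L2 d} (hu : 0 ≤ u) : 0 ≤ semigroup t u := by
  rw [← Lp.coeFn_nonneg] at hu ⊢
  filter_upwards [coeFn_semigroup t u,
    Measure.ae_ae_of_ae_prod ((quasiMeasurePreserving_ouMap t).ae hu)] with v h h1
  rw [h]
  exact integral_nonneg_of_ae h1

/-- The semigroup as a family of bounded operators. -/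
noncomputable def semigroupCLM {d : ℕ} (t : ℝ) : L2 d →L[ℝ] L2 d :=
  LinearMap.mkContinuous
    { toFun := semigroup t
      map_add' := semigroup_add t
      map_smul' := semigroup_smul t }
    (Real.exp (-(d * t) / 2)) (norm_semigroup_le t)

theorem semigroupCLM_apply {d : ℕ} (t : ℝ) (u : L2 d) : semigroupCLM t u = semigroup t u := rfl

/-- Variances of independent centred Gaussians add; characteristic functions determine the measure.
-/
theorem stdGaussian_map_add {d : ℕ} {a b c : ℝ} (h : a ^ 2 + b ^ 2 = c ^ 2) :
    Measure.map (fun p : Vel d × Vel d => a • p.1 + b • p.2)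
      ((stdGaussian (Vel d)).prod (stdGaussian (Vel d))) =
      Measure.map (fun z => c • z) (stdGaussian (Vel d)) := by
  have hchar : ∀ r : ℝ, ∀ x : Vel d, charFun (Measure.map (fun z => r • z) (stdGaussian (Vel d))) x =
      Complex.exp (-(r ^ 2 * ‖x‖ ^ 2) / 2) := by
    intro r x
    rw [charFun_map_smul, charFun_stdGaussian, norm_smul]
    push_cast
    rw [mul_pow, ← Complex.ofReal_pow, Real.norm_eq_abs, sq_abs]
    push_cast
    rfl
  have hp : ∀ r : ℝ, IsProbabilityMeasure (Measure.map (fun z => r • z) (stdGaussian (Vel d))) :=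
    fun r => Measure.isProbabilityMeasure_map (by fun_prop)
  have := hp a
  have := hp b
  have hmap : Measure.map (fun p : Vel d × Vel d => a • p.1 + b • p.2)
      ((stdGaussian (Vel d)).prod (stdGaussian (Vel d))) =
      Measure.map (fun p => p.1 + p.2) ((Measure.map (fun z => a • z) (stdGaussian (Vel d))).prod
        (Measure.map (fun z => b • z) (stdGaussian (Vel d)))) := by
    rw [Measure.map_prod_map _ _ (by fun_prop) (by fun_prop),
      Measure.map_map (by fun_prop) (by fun_prop)]
    rfl
  rw [hmap]
  have := hp c
  refine Measure.ext_of_charFun ?_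
  rw [charFun_map_add_prod_eq_mul]
  ext x
  rw [Pi.mul_apply, hchar, hchar, hchar, ← Complex.exp_add]
  congr 1
  have h' : (a : ℂ) ^ 2 + (b : ℂ) ^ 2 = (c : ℂ) ^ 2 := by exact_mod_cast h
  rw [← h']
  ring

/-- The composition adds two independent Gaussian displacements, and the variances match:
`e^{2t}(e^{2s} - 1) + (e^{2t} - 1) = e^{2(s+t)} - 1`. -/
theorem semigroup_semigroup {d : ℕ} {s t : ℝ} (hs : 0 ≤ s) (ht : 0 ≤ t) (u : L2 d) :
    semigroup s (semigroup t u) = semigroup (s + t) u := by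
  refine Lp.ext ?_
  refine (semigroup_eq_of_ae s _ (coeFn_semigroup t u)).trans ?_
  filter_upwards [coeFn_semigroup (s + t) u, ae_integrable_comp_ouMap (s + t) (Lp.memLp u)]
    with v h1 h2
  rw [h1]
  have hu : StronglyMeasurable (u : Vel d → ℝ) := Lp.stronglyMeasurable u
  have hs1 : (0 : ℝ) ≤ Real.exp (2 * s) - 1 := by
    have := Real.one_le_exp (by positivity : 0 ≤ 2 * s)
    linarith
  have ht1 : (0 : ℝ) ≤ Real.exp (2 * t) - 1 := by
    have := Real.one_le_exp (by positivity : 0 ≤ 2 * t)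
    linarith
  have hst1 : (0 : ℝ) ≤ Real.exp (2 * (s + t)) - 1 := by
    have := Real.one_le_exp (by positivity : 0 ≤ 2 * (s + t))
    linarith
  set F : Vel d → ℝ := fun y => u (Real.exp (s + t) • v - y) with hF
  have hFm : StronglyMeasurable F := hu.comp_measurable (by fun_prop)
  have hvar : (Real.exp t * Real.sqrt (Real.exp (2 * s) - 1)) ^ 2 +
      Real.sqrt (Real.exp (2 * t) - 1) ^ 2 = Real.sqrt (Real.exp (2 * (s + t)) - 1) ^ 2 := by
    rw [mul_pow, Real.sq_sqrt hs1, Real.sq_sqrt ht1, Real.sq_sqrt hst1, ← Real.exp_nat_mul,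
      mul_sub, ← Real.exp_add]
    push_cast
    ring_nf
  have hmap := stdGaussian_map_add (d := d) hvar
  have hint : Integrable F (Measure.map
      (fun z => Real.sqrt (Real.exp (2 * (s + t)) - 1) • z) (stdGaussian (Vel d))) := by
    rw [integrable_map_measure hFm.aestronglyMeasurable (by fun_prop)]
    exact h2
  have hint2 := hint
  rw [← hmap, integrable_map_measure hFm.aestronglyMeasurable (by fun_prop)] at hint2
  calc semigroupFun s (semigroupFun t u) v
      = ∫ z, ∫ z', F ((Real.exp t * Real.sqrt (Real.exp (2 * s) - 1)) • z +
          Real.sqrt (Real.exp (2 * t) - 1) • z') ∂(stdGaussian (Vel d)) ∂(stdGaussian (Vel d)) := by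
        refine integral_congr_ae (Filter.Eventually.of_forall fun z => ?_)
        refine integral_congr_ae (Filter.Eventually.of_forall fun z' => ?_)
        simp only [hF]
        congr 1
        rw [Real.exp_add]
        module
    _ = ∫ p, F ((Real.exp t * Real.sqrt (Real.exp (2 * s) - 1)) • p.1 +
          Real.sqrt (Real.exp (2 * t) - 1) • p.2)
          ∂((stdGaussian (Vel d)).prod (stdGaussian (Vel d))) := (integral_prod _ hint2).symm
    _ = ∫ z, F (Real.sqrt (Real.exp (2 * (s + t)) - 1) • z) ∂(stdGaussian (Vel d)) := by
        rw [← integral_map (by fun_prop) hFm.aestronglyMeasurable, hmap,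
          integral_map (by fun_prop) hFm.aestronglyMeasurable]
    _ = semigroupFun (s + t) u v := rfl

/-- For a test function, the compositions that define the semigroup depend continuously on time. -/
theorem tendsto_eLpNorm_comp_ouMap {d : ℕ} {g : Vel d → ℝ} (hg : Continuous g)
    (hgs : HasCompactSupport g) (t₀ : ℝ) :
    Filter.Tendsto (fun t => eLpNorm (g ∘ ouMap t - g ∘ ouMap t₀) 2
      ((volume : Measure (Vel d)).prod (stdGaussian (Vel d)))) (nhds t₀) (nhds 0) := by
  obtain ⟨B, hB⟩ := hgs.exists_bound_of_continuous hg
  obtain ⟨ρ, hρ⟩ := hgs.isCompact.isBounded.subset_closedBall (0 : Vel d)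
  have hg0 : ∀ x, g x ≠ 0 → ‖x‖ ≤ ρ := fun x hx => by
    simpa using hρ (subset_tsupport g hx)
  have hcm : ∀ t, Continuous (ouMap t : Vel d × Vel d → Vel d) := fun t => by
    unfold ouMap; fun_prop
  have hcv : ∀ v z : Vel d, Continuous fun t => g (ouMap t (v, z)) := fun v z => by
    unfold ouMap; fun_prop
  have hmem : MemLp g 2 volume := hg.memLp_of_hasCompactSupport hgs
  set w : ℝ → Vel d × Vel d → ℝ≥0∞ := fun t p => ‖g (ouMap t p) - g (ouMap t₀ p)‖ₑ ^ 2 with hw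
  have hwm : ∀ t, Measurable (w t) := fun t =>
    (((hg.comp (hcm t)).sub (hg.comp (hcm t₀))).measurable.enorm).pow_const 2
  have hwlim : ∀ v z, Filter.Tendsto (fun t => w t (v, z)) (nhds t₀) (nhds 0) := by
    intro v z
    have h1 : Continuous fun t => w t (v, z) := by
      exact ENNReal.continuous_pow 2 |>.comp ((hcv v z).sub continuous_const).enorm
    have := h1.tendsto t₀
    simpa [hw] using this
  -- Since `√(e^{2t} - 1) ≤ e^t`, for `t` near `t₀` and fixed `z` all the slices are supported in
  -- one ball. This gives a dominating function in `v`.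
  have hsupp : ∀ t, t₀ - 1 ≤ t → ∀ v z : Vel d, g (ouMap t (v, z)) ≠ 0 →
      ‖v‖ ≤ |ρ| * Real.exp (1 - t₀) + ‖z‖ := by
    intro t ht v z h
    have h1 := hg0 _ h
    have hσ : Real.sqrt (Real.exp (2 * t) - 1) ≤ Real.exp t := by
      rw [Real.sqrt_le_left (Real.exp_pos t).le, ← Real.exp_nat_mul]
      push_cast
      linarith
    have h2 : Real.exp t * ‖v‖ ≤ ρ + Real.exp t * ‖z‖ := by
      have h3 : Real.exp t • v = ouMap t (v, z) + Real.sqrt (Real.exp (2 * t) - 1) • z := by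
        simp [ouMap]
      calc Real.exp t * ‖v‖ = ‖Real.exp t • v‖ := by
            rw [norm_smul, Real.norm_of_nonneg (Real.exp_pos t).le]
        _ ≤ ‖ouMap t (v, z)‖ + Real.sqrt (Real.exp (2 * t) - 1) * ‖z‖ := by
            rw [h3]
            refine (norm_add_le _ _).trans ?_
            rw [norm_smul, Real.norm_of_nonneg (Real.sqrt_nonneg _)]
        _ ≤ _ := by gcongr
    have h4 : ‖v‖ ≤ Real.exp (-t) * ρ + ‖z‖ := by
      have := mul_le_mul_of_nonneg_left h2 (Real.exp_pos (-t)).le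
      rw [mul_add, ← mul_assoc, ← mul_assoc, ← Real.exp_add] at this
      simpa using this
    have h5 : Real.exp (-t) * ρ ≤ Real.exp (1 - t₀) * |ρ| :=
      mul_le_mul (Real.exp_le_exp.2 (by linarith)) (le_abs_self ρ) ((norm_nonneg _).trans h1)
        (Real.exp_pos _).le
    linarith
  have hnear : ∀ᶠ t in nhds t₀, t₀ - 1 ≤ t :=
    Filter.Eventually.mono (Ioi_mem_nhds (by linarith : t₀ - 1 < t₀)) fun t ht => le_of_lt ht
  have hinner : ∀ z : Vel d,
      Filter.Tendsto (fun t => ∫⁻ v, w t (v, z)) (nhds t₀) (nhds 0) := by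
    intro z
    have := tendsto_lintegral_filter_of_dominated_convergence (μ := (volume : Measure (Vel d)))
      (l := nhds t₀) (F := fun t v => w t (v, z)) (f := fun _ => 0)
      ((Metric.closedBall (0 : Vel d) (|ρ| * Real.exp (1 - t₀) + ‖z‖)).indicator
        fun _ => ENNReal.ofReal (B + B) ^ 2)
      (Filter.Eventually.of_forall fun t => (hwm t).comp (by fun_prop)) ?_ ?_
      (Filter.Eventually.of_forall fun v => hwlim v z)
    · simpa using this
    · filter_upwards [hnear] with t ht
      refine Filter.Eventually.of_forall fun v => ?_
      by_cases hv : v ∈ Metric.closedBall (0 : Vel d) (|ρ| * Real.exp (1 - t₀) + ‖z‖)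
      · rw [Set.indicator_of_mem hv]
        simp only [hw]
        gcongr
        rw [← ofReal_norm]
        exact ENNReal.ofReal_le_ofReal ((norm_sub_le _ _).trans (add_le_add (hB _) (hB _)))
      · rw [Set.indicator_of_notMem hv]
        have hv' : ∀ t, t₀ - 1 ≤ t → g (ouMap t (v, z)) = 0 := by
          intro t ht
          by_contra h
          exact hv (by simpa using hsupp t ht v z h)
        simp [hw, hv' t ht, hv' t₀ (by linarith)]
    · rw [lintegral_indicator_const Metric.isClosed_closedBall.measurableSet]
      exact ENNReal.mul_ne_top (by simp) (measure_closedBall_lt_top).ne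
  have hslice : ∀ t (z : Vel d), ∫⁻ v, ‖g (ouMap t (v, z))‖ₑ ^ 2 =
      ENNReal.ofReal (Real.exp (-(d * t))) * ∫⁻ v, ‖g v‖ₑ ^ 2 := by
    intro t z
    have h1 := map_affine_volume (d := d) (Real.exp_pos t).ne'
      (-(Real.sqrt (Real.exp (2 * t) - 1) • z))
    have h2 : |(Real.exp t ^ d)⁻¹| = Real.exp (-(d * t)) := by
      rw [abs_of_pos (by positivity), ← Real.exp_nat_mul, ← Real.exp_neg]
    rw [← smul_eq_mul, ← lintegral_smul_measure, ← h2, ← h1,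
      lintegral_map (hg.measurable.enorm.pow_const 2) (by fun_prop)]
    simp only [← sub_eq_add_neg]
    rfl
  set A : ℝ≥0∞ := ∫⁻ v, ‖g v‖ₑ ^ 2 with hA
  have hAt : A ≠ ⊤ := by
    rw [hA, ← sq_eLpNorm_two]
    exact ENNReal.pow_ne_top hmem.2.ne
  -- In `z` a constant dominates: by `hslice` the slice norms do not depend on `z`, and they
  -- decrease in `t`, hence the value at `t₀ - 1`.
  have houter : Filter.Tendsto (fun t => ∫⁻ z, ∫⁻ v, w t (v, z) ∂volume ∂(stdGaussian (Vel d)))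
      (nhds t₀) (nhds 0) := by
    have := tendsto_lintegral_filter_of_dominated_convergence (μ := stdGaussian (Vel d))
      (l := nhds t₀) (F := fun t z => ∫⁻ v, w t (v, z)) (f := fun _ => 0)
      (fun _ => 2 * (ENNReal.ofReal (Real.exp (-(d * (t₀ - 1)))) * A +
        ENNReal.ofReal (Real.exp (-(d * t₀))) * A))
      (Filter.Eventually.of_forall fun t => (hwm t).lintegral_prod_left') ?_ ?_
      (Filter.Eventually.of_forall fun z => hinner z)
    · simpa using this
    · filter_upwards [hnear] with t ht
      refine Filter.Eventually.of_forall fun z => ?_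
      calc ∫⁻ v, w t (v, z) ≤ ∫⁻ v, 2 * (‖g (ouMap t (v, z))‖ₑ ^ 2 + ‖g (ouMap t₀ (v, z))‖ₑ ^ 2) := by
            refine lintegral_mono fun v => ?_
            have h1 : ‖g (ouMap t (v, z)) - g (ouMap t₀ (v, z))‖ₑ ^ 2 ≤
                (‖g (ouMap t (v, z))‖ₑ + ‖g (ouMap t₀ (v, z))‖ₑ) ^ 2 := by
              gcongr
              exact enorm_sub_le
            refine h1.trans ?_
            have h2 := ENNReal.rpow_add_le_mul_rpow_add_rpow ‖g (ouMap t (v, z))‖ₑ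
              ‖g (ouMap t₀ (v, z))‖ₑ one_le_two
            rw [show (2 : ℝ) - 1 = 1 by norm_num, ENNReal.rpow_one] at h2
            simpa only [ENNReal.rpow_two] using h2
        _ = 2 * (ENNReal.ofReal (Real.exp (-(d * t))) * A +
              ENNReal.ofReal (Real.exp (-(d * t₀))) * A) := by
            have hm : Measurable fun v => ‖g (ouMap t (v, z))‖ₑ ^ 2 :=
              ((hg.comp (hcm t)).comp (Continuous.prodMk_left z)).measurable.enorm.pow_const 2
            rw [lintegral_const_mul' _ _ ENNReal.ofNat_ne_top, lintegral_add_left hm, hslice, hslice]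
        _ ≤ _ := by
            gcongr
    · rw [lintegral_const, measure_univ, mul_one]
      exact ENNReal.mul_ne_top ENNReal.ofNat_ne_top (ENNReal.add_ne_top.2
        ⟨ENNReal.mul_ne_top ENNReal.ofReal_ne_top hAt, ENNReal.mul_ne_top ENNReal.ofReal_ne_top hAt⟩)
  have hsq : ∀ t, ∫⁻ z, ∫⁻ v, w t (v, z) ∂volume ∂(stdGaussian (Vel d)) =
      eLpNorm (g ∘ ouMap t - g ∘ ouMap t₀) 2
        ((volume : Measure (Vel d)).prod (stdGaussian (Vel d))) ^ 2 := by
    intro t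
    rw [sq_eLpNorm_two, ← lintegral_prod_symm' _ (hwm t)]
    rfl
  simp only [hsq] at houter
  have := (ENNReal.continuous_rpow_const (y := (1 / 2 : ℝ))).continuousAt.tendsto.comp houter
  rw [ENNReal.zero_rpow_of_pos (by norm_num)] at this
  refine this.congr fun t => ?_
  simp only [Function.comp_apply]
  rw [← ENNReal.rpow_natCast, ← ENNReal.rpow_mul]
  norm_num

/-- Density of continuous compactly supported functions, with a locally uniform operator bound.
Negative times cause no trouble: there the square root is `0` and `P_t` is a mere dilation, so
continuity holds on all of `ℝ`, although the semigroup law is used for nonnegative times only. -/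
theorem continuous_semigroup {d : ℕ} : Continuous fun p : ℝ × L2 d => semigroup p.1 p.2 := by
  rw [continuous_iff_continuousAt]
  rintro ⟨t₀, u₀⟩
  set b : ℝ → ℝ := fun t => Real.exp (-(d * t) / 2) with hb
  have hbc : Continuous b := by fun_prop
  rw [ContinuousAt, tendsto_iff_dist_tendsto_zero]
  refine (Metric.tendsto_nhds.2 fun ε hε => ?_ :
    Filter.Tendsto (fun p : ℝ × L2 d => dist (semigroup p.1 p.2) (semigroup t₀ u₀)) (nhds (t₀, u₀)) (nhds 0))
  -- The three summands bound the three terms of `hsplit`, with `b t₀ + 1` a bound for the operator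
  -- norm near `t₀`.
  obtain ⟨δ, hδ, hδε⟩ : ∃ δ : ℝ, 0 < δ ∧ (b t₀ + 1) * (δ + δ) + δ + b t₀ * δ < ε := by
    have hc : Continuous fun δ : ℝ => (b t₀ + 1) * (δ + δ) + δ + b t₀ * δ := by fun_prop
    have h0 := (hc.tendsto 0).eventually (gt_mem_nhds (by simpa using hε : _ < ε))
    have := (h0.filter_mono nhdsWithin_le_nhds).and (self_mem_nhdsWithin (s := Set.Ioi (0 : ℝ)))
    obtain ⟨δ, h1, h2⟩ := this.exists
    exact ⟨δ, h2, h1⟩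
  obtain ⟨g, hgs, hgu, hgc, hgm⟩ := (Lp.memLp u₀).exists_hasCompactSupport_eLpNorm_sub_le
    ENNReal.ofNat_ne_top (ε := ENNReal.ofReal δ) (by simpa using hδ)
  set G : L2 d := hgm.toLp g with hG
  have huG : ‖u₀ - G‖ ≤ δ := by
    have : u₀ - G = ((Lp.memLp u₀).sub hgm).toLp _ := by
      rw [MemLp.toLp_sub (Lp.memLp u₀) hgm, Lp.toLp_coeFn]
    rw [this, Lp.norm_toLp]
    exact ENNReal.toReal_le_of_le_ofReal hδ.le hgu
  have hGlim : ∀ᶠ t in nhds t₀, ‖semigroup t G - semigroup t₀ G‖ ≤ δ := by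
    filter_upwards [(tendsto_eLpNorm_comp_ouMap hgc hgs t₀).eventually
      (ge_mem_nhds (by simpa using hδ : (0 : ℝ≥0∞) < ENNReal.ofReal δ))] with t ht
    rw [Lp.norm_def]
    refine ENNReal.toReal_le_of_le_ofReal hδ.le (le_trans ?_ ht)
    have hGg : (G : Vel d → ℝ) =ᵐ[volume] g := MemLp.coeFn_toLp _
    have h1 : (semigroup t G - semigroup t₀ G : L2 d) =ᵐ[volume]
        fun v => ∫ z, (g ∘ ouMap t - g ∘ ouMap t₀) (v, z) ∂(stdGaussian (Vel d)) := by
      filter_upwards [Lp.coeFn_sub (semigroup t G) (semigroup t₀ G), semigroup_eq_of_ae t G hGg,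
        semigroup_eq_of_ae t₀ G hGg, ae_integrable_comp_ouMap t hgm,
        ae_integrable_comp_ouMap t₀ hgm] with v h1 h2 h3 h4 h5
      rw [h1, Pi.sub_apply, h2, h3]
      exact (integral_sub h4 h5).symm
    rw [eLpNorm_congr_ae h1]
    exact eLpNorm_two_integral_le ((memLp_comp_ouMap t hgm).1.sub (memLp_comp_ouMap t₀ hgm).1)
  have hev : ∀ᶠ p in nhds (t₀, u₀), b p.1 < b t₀ + 1 ∧ ‖p.2 - u₀‖ < δ ∧
      ‖semigroup p.1 G - semigroup t₀ G‖ ≤ δ := by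
    refine Filter.Eventually.and ?_ (Filter.Eventually.and ?_ ?_)
    · exact ((hbc.comp continuous_fst).tendsto (t₀, u₀)).eventually (gt_mem_nhds (by simp))
    · have hc : Continuous fun p : ℝ × L2 d => ‖p.2 - u₀‖ := by fun_prop
      exact (hc.tendsto (t₀, u₀)).eventually (gt_mem_nhds (by simpa using hδ))
    · exact (continuous_fst.tendsto (t₀, u₀)).eventually hGlim
  filter_upwards [hev] with p hp
  obtain ⟨hp1, hp2, hp3⟩ := hp
  rw [dist_zero_right, Real.norm_of_nonneg dist_nonneg, dist_eq_norm]
  have h1 : ‖p.2 - G‖ ≤ δ + δ := by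
    have := norm_add_le (p.2 - u₀) (u₀ - G)
    rw [sub_add_sub_cancel] at this
    linarith
  have hsplit : semigroup p.1 p.2 - semigroup t₀ u₀ = semigroup p.1 (p.2 - G) +
      (semigroup p.1 G - semigroup t₀ G) - semigroup t₀ (u₀ - G) := by
    simp only [← semigroupCLM_apply, map_sub]
    abel
  have hb0 : 0 < b t₀ := Real.exp_pos _
  have ha : ‖semigroup p.1 (p.2 - G)‖ ≤ (b t₀ + 1) * (δ + δ) :=
    (norm_semigroup_le _ _).trans (mul_le_mul hp1.le h1 (norm_nonneg _) (by positivity))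
  have hc : ‖semigroup t₀ (u₀ - G)‖ ≤ b t₀ * δ :=
    (norm_semigroup_le _ _).trans (mul_le_mul_of_nonneg_left huG hb0.le)
  rw [hsplit]
  have := norm_sub_le (semigroup p.1 (p.2 - G) + (semigroup p.1 G - semigroup t₀ G))
    (semigroup t₀ (u₀ - G))
  have := norm_add_le (semigroup p.1 (p.2 - G)) (semigroup p.1 G - semigroup t₀ G)
  linarith

/-! ### Bounds for the coagulation operator -/

theorem integral_abs_mul_abs_le {α : Type*} [MeasurableSpace α] {μ : Measure α} {f g : α → ℝ}
    (hf : MemLp f 2 μ) (hg : MemLp g 2 μ) :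
    ∫ x, |f x| * |g x| ∂μ ≤ (eLpNorm f 2 μ).toReal * (eLpNorm g 2 μ).toReal := by
  have h : eLpNorm (f • g) 1 μ ≤ eLpNorm f 2 μ * eLpNorm g 2 μ :=
    eLpNorm_smul_le_mul_eLpNorm (p := 2) (q := 2) (r := 1) hg.1 hf.1
  have h1 : ∫ x, |f x| * |g x| ∂μ = (eLpNorm (f • g) 1 μ).toReal := by
    rw [eLpNorm_one_eq_lintegral_enorm, ← integral_norm_eq_lintegral_enorm (hf.1.smul hg.1)]
    simp only [Pi.smul_apply', norm_smul, Real.norm_eq_abs]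
  rw [h1, ← ENNReal.toReal_mul]
  exact ENNReal.toReal_mono (ENNReal.mul_ne_top hf.2.ne hg.2.ne) h

theorem eLpNorm_comp_affine {d : ℕ} {a : ℝ} (ha : a ≠ 0) (b : Vel d) {g : Vel d → ℝ}
    (hg : AEStronglyMeasurable g volume) :
    eLpNorm (fun w => g (a • w + b)) 2 volume =
      ENNReal.ofReal |(a ^ d)⁻¹| ^ (1 / 2 : ℝ) * eLpNorm g 2 volume := by
  have hg' : AEStronglyMeasurable g (Measure.map (fun w => a • w + b) volume) := by
    rw [map_affine_volume ha]
    exact hg.mono_ac Measure.smul_absolutelyContinuous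
  have := eLpNorm_map_measure (p := 2) hg' (by fun_prop : AEMeasurable (fun w => a • w + b) volume)
  rw [map_affine_volume ha, eLpNorm_smul_measure_of_ne_top ENNReal.ofNat_ne_top, smul_eq_mul] at this
  simpa [Function.comp_def] using this.symm

/-- With a single cutoff the kernel is still bounded for each fixed `v`; this gives integrability at
every `v`, without the outer cutoff. -/
theorem abs_dist_mul_cutoff_le {d : ℕ} (R : ℝ) (v w : Vel d) :
    ‖v - w‖ * |cutoff R w| ≤ ‖v‖ + |R| := by
  by_cases hw : w ∈ Metric.ball (0 : Vel d) R
  · have h2 : ‖w‖ < R := by simpa using hw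
    have h3 := norm_sub_le v w
    have h4 := le_abs_self R
    simp [cutoff, hw]
    linarith
  · simp only [cutoff, Set.indicator_of_notMem hw, abs_zero, mul_zero]
    positivity

theorem cutoff_nonneg {d : ℕ} (R : ℝ) (v : Vel d) : 0 ≤ cutoff R v :=
  Set.indicator_nonneg (fun _ _ => zero_le_one) v

/-! ### The gain term as a bounded, positive bilinear map -/

section Gain

variable {d : ℕ} (R : ℝ) (q : ℕ) {n k : ℕ}

theorem gain_velocity_eq (v w : Vel d) :
    (n : ℝ)⁻¹ • (((n + k : ℕ) : ℝ) • v - (k : ℝ) • w) =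
      (-((n : ℝ)⁻¹ * (k : ℝ))) • w + (n : ℝ)⁻¹ • ((n + k : ℕ) : ℝ) • v := by
  module

theorem gain_slope_ne_zero (hn : n ≠ 0) (hk : k ≠ 0) : -((n : ℝ)⁻¹ * (k : ℝ)) ≠ 0 :=
  neg_ne_zero.2 (mul_ne_zero (inv_ne_zero (Nat.cast_ne_zero.2 hn)) (Nat.cast_ne_zero.2 hk))

theorem quasiMeasurePreserving_gain_velocity (hn : n ≠ 0) (hk : k ≠ 0) (v : Vel d) :
    Measure.QuasiMeasurePreserving
      (fun w => (n : ℝ)⁻¹ • (((n + k : ℕ) : ℝ) • v - (k : ℝ) • w)) volume volume := by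
  simp only [gain_velocity_eq]
  exact quasiMeasurePreserving_affine (gain_slope_ne_zero hn hk) _

theorem memLp_comp_gain_velocity (hn : n ≠ 0) (hk : k ≠ 0) (v : Vel d) (g : L2 d) :
    MemLp (fun w => (g : Vel d → ℝ) ((n : ℝ)⁻¹ • (((n + k : ℕ) : ℝ) • v - (k : ℝ) • w)))
      2 volume := by
  refine ⟨(Lp.aestronglyMeasurable g).comp_quasiMeasurePreserving
    (quasiMeasurePreserving_gain_velocity hn hk v), ?_⟩
  simp only [gain_velocity_eq]
  rw [eLpNorm_comp_affine (gain_slope_ne_zero hn hk) _ (Lp.aestronglyMeasurable g)]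
  exact ENNReal.mul_lt_top (ENNReal.rpow_lt_top_of_nonneg (by norm_num) ENNReal.ofReal_ne_top)
    (Lp.eLpNorm_lt_top g)

theorem integrable_gain (hn : n ≠ 0) (hk : k ≠ 0) (g h : L2 d) (v : Vel d) :
    Integrable (fun w => (g : Vel d → ℝ) ((n : ℝ)⁻¹ • (((n + k : ℕ) : ℝ) • v - (k : ℝ) • w)) *
      (h : Vel d → ℝ) w * ‖v - w‖ * (((n + k : ℕ) : ℝ) / (n : ℝ)) ^ q * cutoff R w) volume := by
  have hg := memLp_comp_gain_velocity hn hk v g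
  have hgh := hg.integrable_mul (Lp.memLp h)
  refine ((hgh.abs.const_mul ((‖v‖ + |R|) * |(((n + k : ℕ) : ℝ) / (n : ℝ)) ^ q|))).mono' ?_ ?_
  · exact (((hgh.1.mul (by fun_prop : Measurable fun w : Vel d => ‖v - w‖).aestronglyMeasurable).mul
      aestronglyMeasurable_const).mul (stronglyMeasurable_cutoff R).aestronglyMeasurable)
  · refine Filter.Eventually.of_forall fun w => ?_
    have h1 := abs_dist_mul_cutoff_le R v w
    simp only [Real.norm_eq_abs, abs_mul, abs_norm, Pi.mul_apply]
    calc _ = (‖v - w‖ * |cutoff R w|) * |(((n + k : ℕ) : ℝ) / (n : ℝ)) ^ q| *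
          (|(g : Vel d → ℝ) ((n : ℝ)⁻¹ • (((n + k : ℕ) : ℝ) • v - (k : ℝ) • w))| *
            |(h : Vel d → ℝ) w|) := by ring
      _ ≤ _ := by gcongr

/-- Both cutoffs together bound the kernel by `2|R|`, and Cauchy–Schwarz with an affine change of
variables bounds the rest uniformly in `v`. The factor `|cutoff R v|` turns this sup bound into an
`L²` bound. -/
theorem exists_abs_gainFun_le (hn : n ≠ 0) (hk : k ≠ 0) : ∃ C : ℝ, 0 ≤ C ∧
    ∀ (g h : L2 d) (v : Vel d), |gainFun R q n k g h v| ≤ C * ‖g‖ * ‖h‖ * |cutoff R v| := by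
  refine ⟨2 * |R| * |(((n + k : ℕ) : ℝ) / (n : ℝ)) ^ q| *
    (ENNReal.ofReal |((-((n : ℝ)⁻¹ * (k : ℝ))) ^ d)⁻¹| ^ (1 / 2 : ℝ)).toReal, by positivity, ?_⟩
  intro g h v
  set c := (((n + k : ℕ) : ℝ) / (n : ℝ)) ^ q
  have hg := memLp_comp_gain_velocity hn hk v g
  have hgh := (hg.abs.integrable_mul (Lp.memLp h).abs)
  have hhol := integral_abs_mul_abs_le hg (Lp.memLp h)
  have hn1 : (eLpNorm (fun w => (g : Vel d → ℝ)
      ((n : ℝ)⁻¹ • (((n + k : ℕ) : ℝ) • v - (k : ℝ) • w))) 2 volume).toReal =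
      (ENNReal.ofReal |((-((n : ℝ)⁻¹ * (k : ℝ))) ^ d)⁻¹| ^ (1 / 2 : ℝ)).toReal * ‖g‖ := by
    simp only [gain_velocity_eq]
    rw [eLpNorm_comp_affine (gain_slope_ne_zero hn hk) _ (Lp.aestronglyMeasurable g),
      ENNReal.toReal_mul, Lp.norm_def]
  rw [hn1, ← Lp.norm_def] at hhol
  -- The cutoff is idempotent: one copy is spent on the kernel, the other remains in the estimate.
  have hcc : |cutoff R v| = |cutoff R v| * |cutoff R v| := by
    by_cases hv : v ∈ Metric.ball (0 : Vel d) R <;> simp [cutoff, hv]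
  unfold gainFun
  rw [abs_mul]
  have hstep : |cutoff R v| * |∫ w, (g : Vel d → ℝ)
      ((n : ℝ)⁻¹ • (((n + k : ℕ) : ℝ) • v - (k : ℝ) • w)) * (h : Vel d → ℝ) w * ‖v - w‖ * c *
        cutoff R w| ≤ ∫ w, (2 * |R| * |c|) * (|(g : Vel d → ℝ)
      ((n : ℝ)⁻¹ • (((n + k : ℕ) : ℝ) • v - (k : ℝ) • w))| * |(h : Vel d → ℝ) w|) := by
    rw [← abs_mul, ← integral_const_mul, ← Real.norm_eq_abs]
    refine norm_integral_le_of_norm_le (hgh.const_mul _) (Filter.Eventually.of_forall fun w => ?_)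
    have h1 := abs_cutoff_mul_dist_le R v w
    simp only [Real.norm_eq_abs, abs_mul, abs_norm]
    calc _ = |cutoff R v| * (‖v - w‖ * |cutoff R w|) * (|c| *
          (|(g : Vel d → ℝ) ((n : ℝ)⁻¹ • (((n + k : ℕ) : ℝ) • v - (k : ℝ) • w))| *
            |(h : Vel d → ℝ) w|)) := by ring
      _ ≤ 2 * |R| * (|c| *
          (|(g : Vel d → ℝ) ((n : ℝ)⁻¹ • (((n + k : ℕ) : ℝ) • v - (k : ℝ) • w))| *
            |(h : Vel d → ℝ) w|)) := by gcongr
      _ = _ := by ring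
  conv_lhs => rw [hcc, mul_assoc]
  calc _ ≤ |cutoff R v| * _ := mul_le_mul_of_nonneg_left hstep (abs_nonneg _)
    _ ≤ |cutoff R v| * ((2 * |R| * |c|) *
        ((ENNReal.ofReal |((-((n : ℝ)⁻¹ * (k : ℝ))) ^ d)⁻¹| ^ (1 / 2 : ℝ)).toReal * ‖g‖ * ‖h‖)) := by
        rw [integral_const_mul]
        gcongr
    _ = _ := by ring

theorem gainFun_nonneg (hn : n ≠ 0) (hk : k ≠ 0) {g h : L2 d} (hg : 0 ≤ g) (hh : 0 ≤ h)
    (v : Vel d) : 0 ≤ gainFun R q n k g h v := by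
  rw [← Lp.coeFn_nonneg] at hg hh
  refine mul_nonneg (cutoff_nonneg R v) (integral_nonneg_of_ae ?_)
  filter_upwards [(quasiMeasurePreserving_gain_velocity hn hk v).ae hg, hh] with w h1 h2
  simp only [Pi.zero_apply] at h1 h2 ⊢
  have := cutoff_nonneg R w
  positivity

theorem gainFun_add_left (hn : n ≠ 0) (hk : k ≠ 0) (g g' h : L2 d) (v : Vel d) :
    gainFun R q n k (g + g' : L2 d) h v = gainFun R q n k g h v + gainFun R q n k g' h v := by
  unfold gainFun
  rw [← mul_add, ← integral_add (integrable_gain R q hn hk g h v) (integrable_gain R q hn hk g' h v)]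
  congr 1
  refine integral_congr_ae ?_
  filter_upwards [(quasiMeasurePreserving_gain_velocity hn hk v).ae (Lp.coeFn_add g g')] with w hw
  rw [hw, Pi.add_apply]
  ring

theorem gainFun_smul_left (hn : n ≠ 0) (hk : k ≠ 0) (c : ℝ) (g h : L2 d) (v : Vel d) :
    gainFun R q n k (c • g : L2 d) h v = c * gainFun R q n k g h v := by
  unfold gainFun
  rw [mul_left_comm, ← integral_const_mul c]
  congr 1
  refine integral_congr_ae ?_
  filter_upwards [(quasiMeasurePreserving_gain_velocity hn hk v).ae (Lp.coeFn_smul c g)] with w hw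
  rw [hw, Pi.smul_apply, smul_eq_mul]
  ring

theorem gainFun_add_right (hn : n ≠ 0) (hk : k ≠ 0) (g h h' : L2 d) (v : Vel d) :
    gainFun R q n k g (h + h' : L2 d) v = gainFun R q n k g h v + gainFun R q n k g h' v := by
  unfold gainFun
  rw [← mul_add, ← integral_add (integrable_gain R q hn hk g h v) (integrable_gain R q hn hk g h' v)]
  congr 1
  refine integral_congr_ae ?_
  filter_upwards [Lp.coeFn_add h h'] with w hw
  rw [hw, Pi.add_apply]
  ring

theorem gainFun_smul_right (c : ℝ) (g h : L2 d) (v : Vel d) :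
    gainFun R q n k g (c • h : L2 d) v = c * gainFun R q n k g h v := by
  unfold gainFun
  rw [mul_left_comm, ← integral_const_mul c]
  congr 1
  refine integral_congr_ae ?_
  filter_upwards [Lp.coeFn_smul c h] with w hw
  rw [hw, Pi.smul_apply, smul_eq_mul]
  ring

end Gain

theorem mass_ne_zero {M : ℕ} (i : Fin M) : mass i ≠ 0 := Nat.succ_ne_zero _

theorem coeFn_gain {M d : ℕ} (R : ℝ) (q : ℕ) (n k : Fin M) (g h : L2 d) :
    gain R q n k g h =ᵐ[volume] gainFun R q (mass n) (mass k) g h :=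
  MemLp.coeFn_toLp _

theorem gain_nonneg {M d : ℕ} (R : ℝ) (q : ℕ) (n k : Fin M) {g h : L2 d} (hg : 0 ≤ g)
    (hh : 0 ≤ h) : 0 ≤ gain R q n k g h := by
  rw [← Lp.coeFn_nonneg]
  filter_upwards [coeFn_gain R q n k g h] with v hv
  rw [hv]
  exact gainFun_nonneg R q (mass_ne_zero n) (mass_ne_zero k) hg hh v

theorem exists_norm_gain_le {M d : ℕ} (R : ℝ) (q : ℕ) (n k : Fin M) :
    ∃ C : ℝ, 0 ≤ C ∧ ∀ g h : L2 d, ‖gain R q n k g h‖ ≤ C * ‖g‖ * ‖h‖ := by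
  obtain ⟨C, hC, hb⟩ := exists_abs_gainFun_le (d := d) R q (mass_ne_zero n) (mass_ne_zero k)
  refine ⟨C * ‖(memLp_cutoff (d := d) R).toLp _‖, by positivity, fun g h => ?_⟩
  have := Lp.norm_le_mul_norm_of_ae_le_mul (c := C * ‖g‖ * ‖h‖) (f := gain R q n k g h)
    (g := (memLp_cutoff (d := d) R).toLp _) ?_
  · refine this.trans (le_of_eq ?_)
    ring
  · filter_upwards [coeFn_gain R q n k g h, (memLp_cutoff (d := d) R).coeFn_toLp] with v h1 h2
    rw [h1, h2]
    exact hb g h v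

/-- The gain term as a bounded bilinear map. -/
noncomputable def gainCLM {M d : ℕ} (R : ℝ) (q : ℕ) (n k : Fin M) : L2 d →L[ℝ] L2 d →L[ℝ] L2 d :=
  LinearMap.mkContinuous₂
    (LinearMap.mk₂ ℝ (gain R q n k)
      (fun g g' h => by
        refine Lp.ext ?_
        filter_upwards [coeFn_gain R q n k (g + g') h, coeFn_gain R q n k g h,
          coeFn_gain R q n k g' h, Lp.coeFn_add (gain R q n k g h) (gain R q n k g' h)]
          with v h1 h2 h3 h4
        rw [h1, h4, Pi.add_apply, h2, h3]
        exact gainFun_add_left R q (mass_ne_zero n) (mass_ne_zero k) g g' h v)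
      (fun c g h => by
        refine Lp.ext ?_
        filter_upwards [coeFn_gain R q n k (c • g) h, coeFn_gain R q n k g h,
          Lp.coeFn_smul c (gain R q n k g h)] with v h1 h2 h4
        rw [h1, h4, Pi.smul_apply, h2]
        exact gainFun_smul_left R q (mass_ne_zero n) (mass_ne_zero k) c g h v)
      (fun g h h' => by
        refine Lp.ext ?_
        filter_upwards [coeFn_gain R q n k g (h + h'), coeFn_gain R q n k g h,
          coeFn_gain R q n k g h', Lp.coeFn_add (gain R q n k g h) (gain R q n k g h')]
          with v h1 h2 h3 h4
        rw [h1, h4, Pi.add_apply, h2, h3]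
        exact gainFun_add_right R q (mass_ne_zero n) (mass_ne_zero k) g h h' v)
      (fun c g h => by
        refine Lp.ext ?_
        filter_upwards [coeFn_gain R q n k g (c • h), coeFn_gain R q n k g h,
          Lp.coeFn_smul c (gain R q n k g h)] with v h1 h2 h4
        rw [h1, h4, Pi.smul_apply, h2]
        exact gainFun_smul_right R q c g h v))
    (exists_norm_gain_le R q n k).choose (exists_norm_gain_le R q n k).choose_spec.2

/-! ### The loss term as multiplication by a bounded, nonnegative rate -/

section Loss

variable {d : ℕ} (R : ℝ)

/-- The rate of loss by coagulation with particles of density `h`. -/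
noncomputable def lossRate (h : Vel d → ℝ) (v : Vel d) : ℝ :=
  cutoff R v * ∫ w, h w * ‖v - w‖ * cutoff R w

theorem lossFun_eq (g h : Vel d → ℝ) (v : Vel d) : lossFun R g h v = g v * lossRate R h v := by
  unfold lossFun lossRate
  rw [mul_left_comm, ← integral_const_mul (g v)]
  simp only [mul_assoc]

theorem integrable_loss (h : L2 d) (v : Vel d) :
    Integrable (fun w => (h : Vel d → ℝ) w * ‖v - w‖ * cutoff R w) volume := by
  have hh := (Lp.memLp h).integrable_mul (memLp_cutoff (d := d) R)
  refine ((hh.abs.const_mul (‖v‖ + |R|))).mono' ?_ ?_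
  · exact ((Lp.aestronglyMeasurable h).mul
      (by fun_prop : Measurable fun w : Vel d => ‖v - w‖).aestronglyMeasurable).mul
      (stronglyMeasurable_cutoff R).aestronglyMeasurable
  · refine Filter.Eventually.of_forall fun w => ?_
    have h1 := abs_dist_mul_cutoff_le R v w
    have hcc : |cutoff R w| = |cutoff R w| * |cutoff R w| := by
      by_cases hv : w ∈ Metric.ball (0 : Vel d) R <;> simp [cutoff, hv]
    simp only [Real.norm_eq_abs, abs_mul, abs_norm, Pi.mul_apply]
    rw [hcc]
    calc _ = (‖v - w‖ * |cutoff R w|) * (|(h : Vel d → ℝ) w| * |cutoff R w|) := by ring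
      _ ≤ (‖v‖ + |R|) * (|(h : Vel d → ℝ) w| * |cutoff R w|) := by gcongr
      _ = _ := by rw [← hcc]

theorem exists_abs_lossRate_le : ∃ C : ℝ, 0 ≤ C ∧
    ∀ (h : L2 d) (v : Vel d), |lossRate R h v| ≤ C * ‖h‖ := by
  refine ⟨2 * |R| * (eLpNorm (cutoff R : Vel d → ℝ) 2 volume).toReal, by positivity, ?_⟩
  intro h v
  have hhol := integral_abs_mul_abs_le (Lp.memLp h) (memLp_cutoff (d := d) R)
  have hint : Integrable (fun w => |(h : Vel d → ℝ) w| * |cutoff R w|) volume :=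
    (Lp.memLp h).abs.integrable_mul (memLp_cutoff (d := d) R).abs
  have hstep : |lossRate R h v| ≤ ∫ w, (2 * |R|) * (|(h : Vel d → ℝ) w| * |cutoff R w|) := by
    unfold lossRate
    rw [← integral_const_mul, ← Real.norm_eq_abs]
    refine norm_integral_le_of_norm_le (hint.const_mul _) (Filter.Eventually.of_forall fun w => ?_)
    have h1 := abs_cutoff_mul_dist_le R v w
    have hcc : |cutoff R w| = |cutoff R w| * |cutoff R w| := by
      by_cases hv : w ∈ Metric.ball (0 : Vel d) R <;> simp [cutoff, hv]
    simp only [Real.norm_eq_abs, abs_mul, abs_norm]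
    rw [hcc]
    calc _ = |cutoff R v| * (‖v - w‖ * |cutoff R w|) * (|(h : Vel d → ℝ) w| * |cutoff R w|) := by ring
      _ ≤ 2 * |R| * (|(h : Vel d → ℝ) w| * |cutoff R w|) := by gcongr
      _ = _ := by rw [← hcc]
  rw [integral_const_mul] at hstep
  rw [← Lp.norm_def] at hhol
  calc _ ≤ 2 * |R| * (‖h‖ * (eLpNorm (cutoff R : Vel d → ℝ) 2 volume).toReal) :=
        hstep.trans (mul_le_mul_of_nonneg_left hhol (by positivity))
    _ = _ := by ring

theorem lossRate_nonneg {h : L2 d} (hh : 0 ≤ h) (v : Vel d) : 0 ≤ lossRate R h v := by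
  rw [← Lp.coeFn_nonneg] at hh
  refine mul_nonneg (cutoff_nonneg R v) (integral_nonneg_of_ae ?_)
  filter_upwards [hh] with w h2
  simp only [Pi.zero_apply] at h2 ⊢
  have := cutoff_nonneg R w
  positivity

theorem lossRate_add (h h' : L2 d) (v : Vel d) :
    lossRate R (h + h' : L2 d) v = lossRate R h v + lossRate R h' v := by
  unfold lossRate
  rw [← mul_add, ← integral_add (integrable_loss R h v) (integrable_loss R h' v)]
  congr 1
  refine integral_congr_ae ?_
  filter_upwards [Lp.coeFn_add h h'] with w hw
  rw [hw, Pi.add_apply]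
  ring

theorem lossRate_smul (c : ℝ) (h : L2 d) (v : Vel d) :
    lossRate R (c • h : L2 d) v = c * lossRate R h v := by
  unfold lossRate
  rw [mul_left_comm, ← integral_const_mul c]
  congr 1
  refine integral_congr_ae ?_
  filter_upwards [Lp.coeFn_smul c h] with w hw
  rw [hw, Pi.smul_apply, smul_eq_mul]
  ring

theorem coeFn_loss (g h : L2 d) :
    loss R g h =ᵐ[volume] fun v => (g : Vel d → ℝ) v * lossRate R h v := by
  refine (MemLp.coeFn_toLp (memLp_lossFun R g h)).trans ?_
  exact Filter.Eventually.of_forall fun v => lossFun_eq R g h v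

theorem loss_nonneg {g h : L2 d} (hg : 0 ≤ g) (hh : 0 ≤ h) : 0 ≤ loss R g h := by
  rw [← Lp.coeFn_nonneg] at hg ⊢
  filter_upwards [coeFn_loss R g h, hg] with v hv hgv
  rw [hv]
  exact mul_nonneg hgv (lossRate_nonneg R hh v)

/-- The order bound is the one that matters for positivity: a multiple of `g` absorbs the loss
pointwise, which a norm bound could not give. -/
theorem exists_loss_le : ∃ C : ℝ, 0 ≤ C ∧ (∀ g h : L2 d, ‖loss R g h‖ ≤ C * ‖g‖ * ‖h‖) ∧
    ∀ g h : L2 d, 0 ≤ g → loss R g h ≤ (C * ‖h‖) • g := by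
  obtain ⟨C, hC, hb⟩ := exists_abs_lossRate_le (d := d) R
  refine ⟨C, hC, fun g h => ?_, fun g h hg => ?_⟩
  · have := Lp.norm_le_mul_norm_of_ae_le_mul (c := C * ‖h‖) (f := loss R g h) (g := g) ?_
    · refine this.trans (le_of_eq ?_)
      ring
    · filter_upwards [coeFn_loss R g h] with v h1
      rw [h1, norm_mul, mul_comm]
      exact mul_le_mul_of_nonneg_right (hb h v) (norm_nonneg _)
  · rw [← Lp.coeFn_nonneg] at hg
    rw [← Lp.coeFn_le]
    filter_upwards [coeFn_loss R g h, hg, Lp.coeFn_smul (C * ‖h‖) g] with v h1 h2 h3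
    rw [h1, h3, Pi.smul_apply, smul_eq_mul, mul_comm]
    exact mul_le_mul_of_nonneg_right ((le_abs_self _).trans (hb h v)) h2

/-- The loss term as a bounded bilinear map. -/
noncomputable def lossCLM : L2 d →L[ℝ] L2 d →L[ℝ] L2 d :=
  LinearMap.mkContinuous₂
    (LinearMap.mk₂ ℝ (loss R)
      (fun g g' h => by
        refine Lp.ext ?_
        filter_upwards [coeFn_loss R (g + g') h, coeFn_loss R g h, coeFn_loss R g' h,
          Lp.coeFn_add (loss R g h) (loss R g' h), Lp.coeFn_add g g'] with v h1 h2 h3 h4 h5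
        rw [h1, h4, Pi.add_apply, h2, h3, h5, Pi.add_apply, add_mul])
      (fun c g h => by
        refine Lp.ext ?_
        filter_upwards [coeFn_loss R (c • g) h, coeFn_loss R g h,
          Lp.coeFn_smul c (loss R g h), Lp.coeFn_smul c g] with v h1 h2 h4 h5
        rw [h1, h4, Pi.smul_apply, h2, h5, Pi.smul_apply, smul_mul_assoc])
      (fun g h h' => by
        refine Lp.ext ?_
        filter_upwards [coeFn_loss R g (h + h'), coeFn_loss R g h, coeFn_loss R g h',
          Lp.coeFn_add (loss R g h) (loss R g h')] with v h1 h2 h3 h4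
        rw [h1, h4, Pi.add_apply, h2, h3, lossRate_add, mul_add])
      (fun c g h => by
        refine Lp.ext ?_
        filter_upwards [coeFn_loss R g (c • h), coeFn_loss R g h,
          Lp.coeFn_smul c (loss R g h)] with v h1 h2 h4
        rw [h1, h4, Pi.smul_apply, h2, lossRate_smul, smul_eq_mul, mul_left_comm]))
    (exists_loss_le R).choose (exists_loss_le R).choose_spec.2.1

end Loss

/-! ### Radial truncation -/

section Truncation

variable {E : Type*} [NormedAddCommGroup E]

theorem radial_factor_nonneg {N : ℝ} (hN : 0 < N) (a : E) : 0 ≤ N / max N ‖a‖ :=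
  div_nonneg hN.le (hN.le.trans (le_max_left _ _))

theorem radial_factor_le_one {N : ℝ} (hN : 0 < N) (a : E) : N / max N ‖a‖ ≤ 1 :=
  (div_le_one (hN.trans_le (le_max_left _ _))).2 (le_max_left _ _)

variable [NormedSpace ℝ E]

/-- The radial retraction onto the closed ball of radius `N`. -/
noncomputable def radial (N : ℝ) (a : E) : E := (N / max N ‖a‖) • a

theorem norm_radial_le {N : ℝ} (hN : 0 < N) (a : E) : ‖radial N a‖ ≤ N := by
  have h : 0 < max N ‖a‖ := hN.trans_le (le_max_left _ _)
  rw [radial, norm_smul, Real.norm_of_nonneg (radial_factor_nonneg hN a), div_mul_eq_mul_div,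
    div_le_iff₀ h]
  exact mul_le_mul_of_nonneg_left (le_max_right _ _) hN.le

theorem norm_radial_le_norm {N : ℝ} (hN : 0 < N) (a : E) : ‖radial N a‖ ≤ ‖a‖ := by
  rw [radial, norm_smul, Real.norm_of_nonneg (radial_factor_nonneg hN a)]
  exact mul_le_of_le_one_left (norm_nonneg _) (radial_factor_le_one hN a)

theorem radial_eq_self {N : ℝ} (hN : 0 < N) {a : E} (h : ‖a‖ ≤ N) : radial N a = a := by
  rw [radial, max_eq_left h, div_self hN.ne', one_smul]

/-- One `‖a - b‖` comes from moving the vector, the other from the change of the scalar factor. The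
constant `2` needs no inner product. -/
theorem norm_radial_sub_le {N : ℝ} (hN : 0 < N) (a b : E) :
    ‖radial N a - radial N b‖ ≤ 2 * ‖a - b‖ := by
  have ha : 0 < max N ‖a‖ := hN.trans_le (le_max_left _ _)
  have hb : 0 < max N ‖b‖ := hN.trans_le (le_max_left _ _)
  have hsplit : radial N a - radial N b =
      (N / max N ‖a‖) • (a - b) + (N / max N ‖a‖ - N / max N ‖b‖) • b := by
    unfold radial
    module
  have h1 : ‖(N / max N ‖a‖) • (a - b)‖ ≤ ‖a - b‖ := by
    rw [norm_smul, Real.norm_of_nonneg (radial_factor_nonneg hN a)]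
    exact mul_le_of_le_one_left (norm_nonneg _) (radial_factor_le_one hN a)
  have h2 : ‖(N / max N ‖a‖ - N / max N ‖b‖) • b‖ ≤ ‖a - b‖ := by
    have h3 : N / max N ‖a‖ - N / max N ‖b‖ =
        (N / max N ‖a‖) * ((max N ‖b‖ - max N ‖a‖) / max N ‖b‖) := by
      field_simp
    have h4 : |max N ‖b‖ - max N ‖a‖| ≤ ‖a - b‖ := by
      have h5 := abs_max_sub_max_le_abs ‖b‖ ‖a‖ N
      rw [max_comm N, max_comm N, ← norm_sub_rev b a]
      exact h5.trans (abs_norm_sub_norm_le b a)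
    rw [norm_smul, Real.norm_eq_abs, h3, abs_mul, abs_of_nonneg (radial_factor_nonneg hN a), abs_div,
      abs_of_pos hb]
    calc N / max N ‖a‖ * (|max N ‖b‖ - max N ‖a‖| / max N ‖b‖) * ‖b‖
        = N / max N ‖a‖ * |max N ‖b‖ - max N ‖a‖| * (‖b‖ / max N ‖b‖) := by ring
      _ ≤ 1 * ‖a - b‖ * 1 := by
          gcongr
          · exact radial_factor_le_one hN a
          · exact (div_le_one hb).2 (le_max_right _ _)
      _ = ‖a - b‖ := by ring
  rw [hsplit]
  linarith [norm_add_le ((N / max N ‖a‖) • (a - b)) ((N / max N ‖a‖ - N / max N ‖b‖) • b)]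

end Truncation

theorem smul_L2_nonneg {d : ℕ} {c : ℝ} (hc : 0 ≤ c) {u : L2 d} (hu : 0 ≤ u) : 0 ≤ c • u := by
  rw [← Lp.coeFn_nonneg] at hu ⊢
  filter_upwards [hu, Lp.coeFn_smul c u] with v h1 h2
  rw [h2]
  exact mul_nonneg hc h1

theorem integral_L2_nonneg {d : ℕ} {t : ℝ} (ht : 0 ≤ t) {u : ℝ → L2 d}
    (hu : ∀ s ∈ Set.Icc 0 t, 0 ≤ u s) : 0 ≤ ∫ s in (0 : ℝ)..t, u s := by
  have : IsOrderedModule ℝ (L2 d) := IsOrderedModule.of_smul_nonneg fun c hc u hu => smul_L2_nonneg hc hu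
  rw [intervalIntegral.integral_of_le ht]
  refine integral_nonneg_of_ae ?_
  exact (ae_restrict_mem measurableSet_Ioc).mono fun s hs => hu s (Set.Ioc_subset_Icc_self hs)

theorem radial_nonneg {d : ℕ} {N : ℝ} (hN : 0 < N) {u : L2 d} (hu : 0 ≤ u) : 0 ≤ radial N u :=
  smul_L2_nonneg (radial_factor_nonneg hN u) hu

theorem radial_le {d : ℕ} {N : ℝ} (hN : 0 < N) {u : L2 d} (hu : 0 ≤ u) : radial N u ≤ u := by
  have := smul_L2_nonneg (sub_nonneg.2 (radial_factor_le_one hN u)) hu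
  rw [sub_smul, one_smul, sub_nonneg] at this
  exact this

/-! ### The truncated problem as an evolution equation in `L²_M` -/

/-- The semigroup acting on all components. -/
noncomputable def stateSemigroup {M d : ℕ} (t : ℝ) : State M d →L[ℝ] State M d :=
  ContinuousLinearMap.pi fun m => (semigroupCLM t).comp (ContinuousLinearMap.proj m)

theorem stateSemigroup_apply {M d : ℕ} (t : ℝ) (f : State M d) (m : Fin M) :
    stateSemigroup t f m = semigroup t (f m) := rfl

theorem norm_semigroup_le_norm {d : ℕ} {t : ℝ} (ht : 0 ≤ t) (u : L2 d) : ‖semigroup t u‖ ≤ ‖u‖ := by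
  refine (norm_semigroup_le t u).trans (mul_le_of_le_one_left (norm_nonneg _) ?_)
  rw [Real.exp_le_one_iff]
  have : 0 ≤ (d : ℝ) * t := by positivity
  linarith

theorem norm_stateSemigroup_le {M d : ℕ} {t : ℝ} (ht : 0 ≤ t) (f : State M d) :
    ‖stateSemigroup t f‖ ≤ ‖f‖ :=
  (pi_norm_le_iff_of_nonneg (norm_nonneg _)).2 fun m =>
    (norm_semigroup_le_norm ht (f m)).trans (norm_le_pi_norm f m)

theorem continuous_stateSemigroup {M d : ℕ} :
    Continuous fun p : ℝ × State M d => stateSemigroup p.1 p.2 :=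
  continuous_pi fun m => continuous_semigroup.comp
    (continuous_fst.prodMk ((continuous_apply m).comp continuous_snd))

theorem stateSemigroup_stateSemigroup {M d : ℕ} (s t : ℝ) (hs : 0 ≤ s) (ht : 0 ≤ t)
    (f : State M d) : stateSemigroup s (stateSemigroup t f) = stateSemigroup (s + t) f :=
  funext fun m => semigroup_semigroup hs ht (f m)

theorem norm_bilinear_sub_le {E F G : Type*} [NormedAddCommGroup E] [NormedSpace ℝ E]
    [NormedAddCommGroup F] [NormedSpace ℝ F] [NormedAddCommGroup G] [NormedSpace ℝ G]
    (B : E →L[ℝ] F →L[ℝ] G) {N : ℝ} {a a' : E} {b b' : F} (hb : ‖b‖ ≤ N) (ha' : ‖a'‖ ≤ N) :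
    ‖B a b - B a' b'‖ ≤ ‖B‖ * N * (‖a - a'‖ + ‖b - b'‖) := by
  have h : B a b - B a' b' = B (a - a') b + B a' (b - b') := by
    simp only [map_sub, sub_apply]
    abel
  rw [h]
  refine (norm_add_le _ _).trans ?_
  have h1 := B.le_opNorm₂ (a - a') b
  have h2 := B.le_opNorm₂ a' (b - b')
  have h3 : ‖B‖ * ‖a - a'‖ * ‖b‖ ≤ ‖B‖ * ‖a - a'‖ * N := by gcongr
  have h4 : ‖B‖ * ‖a'‖ * ‖b - b'‖ ≤ ‖B‖ * N * ‖b - b'‖ := by gcongr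
  linarith

/-! ### Lipschitz bounds, positivity and the problem with truncated nonlinearity -/

section Operator

variable {M d : ℕ} (R : ℝ) (q : ℕ)

/-- The gain part of the coagulation operator. -/
noncomputable def totalGain (f : State M d) (m : Fin M) : L2 d :=
  ∑ n : Fin M, ∑ k : Fin M, if mass n + mass k = mass m then gain R q n k (f n) (f k) else 0

/-- Half the loss part of the coagulation operator. -/
noncomputable def totalLoss (f : State M d) (m : Fin M) : L2 d := ∑ n : Fin M, loss R (f m) (f n)

theorem Q_eq (f : State M d) (m : Fin M) :
    Q R q f m = totalGain R q f m - (2 : ℝ) • totalLoss R f m := rfl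

theorem continuous_totalGain : Continuous (totalGain R q : State M d → State M d) := by
  refine continuous_pi fun m => continuous_finsetSum _ fun n _ => continuous_finsetSum _ fun k _ => ?_
  split_ifs
  · exact (gainCLM R q n k).isBoundedBilinearMap.continuous.comp
      (f := fun f : State M d => (f n, f k)) ((continuous_apply n).prodMk (continuous_apply k))
  · exact continuous_const

theorem continuous_totalLoss : Continuous (totalLoss R : State M d → State M d) :=
  continuous_pi fun m => continuous_finsetSum _ fun n _ =>
    (lossCLM R).isBoundedBilinearMap.continuous.comp (f := fun f : State M d => (f m, f n))
      ((continuous_apply m).prodMk (continuous_apply n))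

theorem continuous_Q : Continuous (Q R q : State M d → State M d) :=
  (continuous_totalGain R q).sub ((continuous_totalLoss R).const_smul (2 : ℝ))

theorem exists_norm_Q_sub_le {N : ℝ} (hN : 0 ≤ N) : ∃ L : ℝ, 0 ≤ L ∧ ∀ f f' : State M d,
    (∀ m, ‖f m‖ ≤ N) → (∀ m, ‖f' m‖ ≤ N) → ‖Q R q f - Q R q f'‖ ≤ L * ‖f - f'‖ := by
  refine ⟨(∑ n : Fin M, ∑ k : Fin M, ‖gainCLM (d := d) R q n k‖ * N * 2) +
    2 * ∑ _n : Fin M, ‖lossCLM (d := d) R‖ * N * 2, by positivity, fun f f' hf hf' => ?_⟩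
  have hc : ∀ m, ‖f m - f' m‖ ≤ ‖f - f'‖ := fun m => norm_le_pi_norm (f - f') m
  rw [pi_norm_le_iff_of_nonneg (by positivity)]
  intro m
  have hsplit : (Q R q f - Q R q f') m = (totalGain R q f m - totalGain R q f' m) -
      (2 : ℝ) • (totalLoss R f m - totalLoss R f' m) := by
    rw [Pi.sub_apply, Q_eq, Q_eq]
    module
  have hg : ‖totalGain R q f m - totalGain R q f' m‖ ≤
      (∑ n : Fin M, ∑ k : Fin M, ‖gainCLM (d := d) R q n k‖ * N * 2) * ‖f - f'‖ := by
    simp only [totalGain, ← Finset.sum_sub_distrib, Finset.sum_mul]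
    refine norm_sum_le_of_le _ fun n _ => norm_sum_le_of_le _ fun k _ => ?_
    split_ifs
    · refine (norm_bilinear_sub_le (gainCLM R q n k) (hf k) (hf' n)).trans ?_
      rw [mul_assoc _ (2 : ℝ)]
      gcongr
      linarith [hc n, hc k]
    · rw [sub_self, norm_zero]
      positivity
  have hl : ‖totalLoss R f m - totalLoss R f' m‖ ≤
      (∑ _n : Fin M, ‖lossCLM (d := d) R‖ * N * 2) * ‖f - f'‖ := by
    simp only [totalLoss, ← Finset.sum_sub_distrib, Finset.sum_mul]
    refine norm_sum_le_of_le _ fun n _ => ?_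
    refine (norm_bilinear_sub_le (lossCLM R) (hf n) (hf' m)).trans ?_
    rw [mul_assoc _ (2 : ℝ)]
    gcongr
    linarith [hc n, hc m]
  rw [hsplit, add_mul, mul_assoc]
  refine (norm_sub_le _ _).trans (add_le_add hg ?_)
  rw [norm_smul, Real.norm_of_nonneg zero_le_two]
  exact mul_le_mul_of_nonneg_left hl zero_le_two

theorem totalGain_nonneg {f : State M d} (hf : ∀ m, 0 ≤ f m) (m : Fin M) :
    0 ≤ totalGain R q f m := by
  refine Finset.sum_nonneg fun n _ => Finset.sum_nonneg fun k _ => ?_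
  split_ifs
  · exact gain_nonneg R q n k (hf n) (hf k)
  · exact le_rfl

theorem totalLoss_nonneg {f : State M d} (hf : ∀ m, 0 ≤ f m) (m : Fin M) :
    0 ≤ totalLoss R f m :=
  Finset.sum_nonneg fun n _ => loss_nonneg R (hf m) (hf n)

theorem exists_totalLoss_le {N : ℝ} (hN : 0 ≤ N) : ∃ C : ℝ, 0 ≤ C ∧ ∀ f : State M d, (∀ m, 0 ≤ f m) →
    (∀ m, ‖f m‖ ≤ N) → ∀ m, totalLoss R f m ≤ C • f m := by
  obtain ⟨C, hC, -, hb⟩ := exists_loss_le (d := d) R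
  refine ⟨∑ _n : Fin M, C * N, by positivity, fun f hf hfN m => ?_⟩
  rw [Finset.sum_smul]
  refine Finset.sum_le_sum fun n _ => (hb _ _ (hf m)).trans ?_
  have := smul_L2_nonneg (mul_nonneg hC (sub_nonneg.2 (hfN n))) (hf m)
  rw [mul_sub, sub_smul, sub_nonneg] at this
  exact this

/-- The operator `f ↦ d f + Q(f, f)` with the arguments of `Q` truncated at norm `N`. -/
noncomputable def truncatedRhs (N : ℝ) (f : State M d) : State M d :=
  (d : ℝ) • f + Q R q fun m => radial N (f m)

theorem exists_norm_truncatedRhs_sub_le {N : ℝ} (hN : 0 < N) : ∃ L : ℝ, 0 ≤ L ∧ ∀ f f' : State M d,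
    ‖truncatedRhs R q N f - truncatedRhs R q N f'‖ ≤ L * ‖f - f'‖ := by
  obtain ⟨L, hL, hb⟩ := exists_norm_Q_sub_le (M := M) (d := d) R q hN.le
  refine ⟨d + L * 2, by positivity, fun f f' => ?_⟩
  have h1 := hb (fun m => radial N (f m)) (fun m => radial N (f' m))
    (fun m => norm_radial_le hN _) (fun m => norm_radial_le hN _)
  have h2 : ‖(fun m => radial N (f m)) - fun m => radial N (f' m)‖ ≤ 2 * ‖f - f'‖ := by
    rw [pi_norm_le_iff_of_nonneg (by positivity)]
    intro m
    refine (norm_radial_sub_le hN (f m) (f' m)).trans ?_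
    exact mul_le_mul_of_nonneg_left (norm_le_pi_norm (f - f') m) zero_le_two
  have h3 : truncatedRhs R q N f - truncatedRhs R q N f' = (d : ℝ) • (f - f') +
      (Q R q (fun m => radial N (f m)) - Q R q fun m => radial N (f' m)) := by
    unfold truncatedRhs
    module
  rw [h3]
  refine (norm_add_le _ _).trans ?_
  rw [norm_smul, Real.norm_of_nonneg (Nat.cast_nonneg d), add_mul, mul_assoc]
  exact add_le_add le_rfl (h1.trans (mul_le_mul_of_nonneg_left h2 hL))

/-- After a shift, the truncated right-hand side preserves nonnegativity. -/
theorem exists_truncatedRhs_add_nonneg {N : ℝ} (hN : 0 < N) : ∃ κ : ℝ, 0 ≤ κ ∧ ∀ f : State M d,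
    (∀ m, 0 ≤ f m) → ∀ m, 0 ≤ truncatedRhs R q N f m + κ • f m := by
  obtain ⟨C, hC, hb⟩ := exists_totalLoss_le (M := M) (d := d) R hN.le
  refine ⟨2 * C, by positivity, fun f hf m => ?_⟩
  have hr : ∀ m, 0 ≤ radial N (f m) := fun m => radial_nonneg hN (hf m)
  have h1 := hb (fun m => radial N (f m)) hr (fun m => norm_radial_le hN _) m
  -- With `r` the retraction of `f`, the right-hand side plus `2C f` is the sum of `2C (f - r)`, `2
  -- (C r - totalLoss r)`, `d f` and `totalGain r`, each nonnegative.
  have h2 : 0 ≤ (2 * C) • (f m - radial N (f m)) :=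
    smul_L2_nonneg (by positivity) (sub_nonneg.2 (radial_le hN (hf m)))
  have h3 : 0 ≤ (2 : ℝ) • (C • radial N (f m) - totalLoss R (fun m => radial N (f m)) m) :=
    smul_L2_nonneg zero_le_two (sub_nonneg.2 h1)
  have h4 : 0 ≤ (d : ℝ) • f m := smul_L2_nonneg (Nat.cast_nonneg d) (hf m)
  have h5 := totalGain_nonneg R q hr m
  have h6 := add_nonneg (add_nonneg h2 h3) (add_nonneg h4 h5)
  refine h6.trans (le_of_eq ?_)
  simp only [truncatedRhs, Pi.add_apply, Pi.smul_apply, Q_eq]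
  module

theorem intervalIntegral_apply {u : ℝ → State M d} {a b : ℝ}
    (hu : IntervalIntegrable u volume a b) (m : Fin M) :
    (∫ s in a..b, u s) m = ∫ s in a..b, u s m :=
  ((ContinuousLinearMap.proj (R := ℝ) (φ := fun _ : Fin M => L2 d) m).intervalIntegral_comp_comm
    hu).symm

/-- The problem with truncated nonlinearity has a nonnegative mild solution. -/
theorem exists_truncated_solution {N T : ℝ} (hN : 0 < N) (hT : 0 ≤ T) {f0 : State M d}
    (hf0 : ∀ m, 0 ≤ f0 m) : ∃ f : ℝ → State M d, Continuous f ∧ (∀ t m, 0 ≤ f t m) ∧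
      ∀ t ∈ Set.Icc 0 T, f t = stateSemigroup t f0 +
        ∫ s in (0 : ℝ)..t, stateSemigroup (t - s) (truncatedRhs R q N (f s)) := by
  obtain ⟨L, hL, hLip⟩ := exists_norm_truncatedRhs_sub_le (M := M) (d := d) R q hN
  obtain ⟨κ, hκ, hpos⟩ := exists_truncatedRhs_add_nonneg (M := M) (d := d) R q hN
  have hclosed : IsClosed {f : State M d | ∀ m, 0 ≤ f m} := by
    simp only [Set.ofPred_forall]
    exact isClosed_iInter fun m => isClosed_le continuous_const (continuous_apply m)
  refine exists_mild_solution_mem_cone (stateSemigroup (M := M) (d := d))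
    continuous_stateSemigroup (fun t ht f => norm_stateSemigroup_le ht f)
    stateSemigroup_stateSemigroup hT hL hκ (truncatedRhs R q N) hLip {f | ∀ m, 0 ≤ f m} hclosed
    (fun f hf g hg m => add_nonneg (hf m) (hg m)) (fun c hc f hf m => smul_L2_nonneg hc (hf m))
    ?_ (fun t f hf m => semigroup_nonneg t (hf m)) hpos hf0
  intro u t ht hu hpos m
  rw [intervalIntegral_apply (hu.intervalIntegrable _ _)]
  exact integral_L2_nonneg ht fun s _ => hpos s m

end Operator

/-! ### A priori bound, uniqueness and gluing -/

section Global

variable {M d : ℕ} {R : ℝ} {q : ℕ} {f0 : State M d}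

/-- Nonnegative solutions of the problem with truncated nonlinearity are bounded on bounded time
intervals, uniformly in the truncation: the gain of mass `m` involves smaller masses only. -/
theorem exists_bound_truncated_solution (R : ℝ) (q : ℕ) (T : ℝ) (f0 : State M d) :
    ∃ B : ℝ, ∀ (N : ℝ) (f : ℝ → State M d), 0 < N → Continuous f → (∀ t m, 0 ≤ f t m) →
      (∀ t ∈ Set.Icc 0 T, f t = stateSemigroup t f0 +
        ∫ s in (0 : ℝ)..t, stateSemigroup (t - s) (truncatedRhs R q N (f s))) →
      ∀ t ∈ Set.Icc 0 T, ∀ m, ‖f t m‖ ≤ B := by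
  -- Induction on the number `j` of smallest masses already bounded; `B` is chosen before `N`, which
  -- makes it uniform in the truncation.
  suffices h : ∀ j : ℕ, ∃ B : ℝ, 0 ≤ B ∧ ∀ (N : ℝ) (f : ℝ → State M d), 0 < N → Continuous f →
      (∀ t m, 0 ≤ f t m) → (∀ t ∈ Set.Icc 0 T, f t = stateSemigroup t f0 +
        ∫ s in (0 : ℝ)..t, stateSemigroup (t - s) (truncatedRhs R q N (f s))) →
      ∀ t ∈ Set.Icc 0 T, ∀ m : Fin M, (m : ℕ) < j → ‖f t m‖ ≤ B by
    obtain ⟨B, -, hB⟩ := h M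
    exact ⟨B, fun N f h1 h2 h3 h4 t ht m => hB N f h1 h2 h3 h4 t ht m m.2⟩
  intro j
  induction j with
  | zero => exact ⟨0, le_rfl, fun _ _ _ _ _ _ _ _ m hm => absurd hm (Nat.not_lt_zero _)⟩
  | succ j ih =>
    obtain ⟨B, hB, hb⟩ := ih
    set c : ℝ := ∑ n : Fin M, ∑ k : Fin M, ‖gainCLM (d := d) R q n k‖ * B * B with hc
    have hc0 : 0 ≤ c := by positivity
    -- `c` bounds the gain of the next mass by the smaller ones; the exponent `d * T` comes from the
    -- linear term `d f`.
    refine ⟨max B ((‖f0‖ + c * T) * Real.exp (d * T)), hB.trans (le_max_left _ _), ?_⟩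
    intro N f hN hf hpos hsol t ht m hm
    have hT : 0 ≤ T := ht.1.trans ht.2
    rcases Nat.lt_succ_iff_lt_or_eq.1 hm with hlt | heq
    · exact (hb N f hN hf hpos hsol t ht m hlt).trans (le_max_left _ _)
    refine le_trans ?_ (le_max_right _ _)
    set ρ : ℝ → State M d := fun s n => radial N (f s n) with hρ
    have hρpos : ∀ s n, 0 ≤ ρ s n := fun s n => radial_nonneg hN (hpos s n)
    have hρc : Continuous ρ := by
      refine continuous_pi fun n => ?_
      have h1 : Continuous fun s => f s n := (continuous_apply n).comp hf
      have h2 : Continuous fun s => N / max N ‖f s n‖ :=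
        continuous_const.div (continuous_const.max h1.norm)
          fun s => (hN.trans_le (le_max_left _ _)).ne'
      exact h2.smul h1
    have hgain : ∀ s ∈ Set.Icc 0 T, ‖totalGain R q (ρ s) m‖ ≤ c := by
      intro s hs
      refine norm_sum_le_of_le _ fun n _ => norm_sum_le_of_le _ fun k _ => ?_
      split_ifs with hnk
      -- Masses are at least `1`, so both partners in the gain are strictly lighter than `m`. The
      -- retraction does not increase norms, so their bound `B` applies whatever `N` is.
      · have hn : (n : ℕ) < j := by unfold mass at hnk; omega
        have hk : (k : ℕ) < j := by unfold mass at hnk; omega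
        have h1 := (norm_radial_le_norm hN (f s n)).trans (hb N f hN hf hpos hsol s hs n hn)
        have h2 := (norm_radial_le_norm hN (f s k)).trans (hb N f hN hf hpos hsol s hs k hk)
        refine ((gainCLM R q n k).le_opNorm₂ _ _).trans ?_
        gcongr
      · rw [norm_zero]
        positivity
    have hkey : ∀ x ∈ Set.Icc 0 T, ‖f x m‖ ≤ (‖f0‖ + c * T) + d * ∫ s in (0 : ℝ)..x, ‖f s m‖ := by
      intro x hx
      have hfm : Continuous fun s => f s m := (continuous_apply m).comp hf
      have hSc : ∀ u : ℝ → L2 d, Continuous u → Continuous fun s => semigroup (x - s) (u s) := by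
        intro u hu
        have h2 : Continuous fun s => x - s := by fun_prop
        exact continuous_semigroup.comp (h2.prodMk hu)
      have hGc : Continuous fun s => (d : ℝ) • f s m + totalGain R q (ρ s) m := by
        have h1 : Continuous fun s => (d : ℝ) • f s m := hfm.const_smul (d : ℝ)
        have h2 : Continuous fun s => totalGain R q (ρ s) m :=
          (continuous_apply m).comp ((continuous_totalGain R q).comp hρc)
        exact h1.add h2
      have hLc : Continuous fun s => totalLoss R (ρ s) m :=
        (continuous_apply m).comp ((continuous_totalLoss R).comp hρc)
      have hrhs : ∀ s, truncatedRhs R q N (f s) m =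
          ((d : ℝ) • f s m + totalGain R q (ρ s) m) - (2 : ℝ) • totalLoss R (ρ s) m := by
        intro s
        simp only [truncatedRhs, Pi.add_apply, Pi.smul_apply, Q_eq]
        abel
      have hrc : Continuous fun s => truncatedRhs R q N (f s) :=
        (hf.const_smul (d : ℝ)).add ((continuous_Q R q).comp hρc)
      have hint : IntervalIntegrable (fun s => stateSemigroup (x - s) (truncatedRhs R q N (f s)))
          volume 0 x := by
        have h2 : Continuous fun s => x - s := by fun_prop
        exact (continuous_stateSemigroup.comp (h2.prodMk hrc)).intervalIntegrable _ _
      have heqn : f x m = (semigroup x (f0 m) + ∫ s in (0 : ℝ)..x,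
          semigroup (x - s) ((d : ℝ) • f s m + totalGain R q (ρ s) m)) -
          (2 : ℝ) • ∫ s in (0 : ℝ)..x, semigroup (x - s) (totalLoss R (ρ s) m) := by
        have h1 := congrFun (hsol x hx) m
        rw [Pi.add_apply, intervalIntegral_apply hint] at h1
        simp only [stateSemigroup_apply, hrhs, ← semigroupCLM_apply, map_sub, map_smul] at h1
        have hGi : IntervalIntegrable (fun s => semigroupCLM (x - s)
            ((d : ℝ) • f s m + totalGain R q (ρ s) m)) volume 0 x := (hSc _ hGc).intervalIntegrable _ _
        have hLi : IntervalIntegrable (fun s => (2 : ℝ) • semigroupCLM (x - s)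
            (totalLoss R (ρ s) m)) volume 0 x := ((hSc _ hLc).const_smul (2 : ℝ)).intervalIntegrable _ _
        simp only [map_add, map_smul] at hGi
        rw [h1, intervalIntegral.integral_sub (by simpa using hGi) hLi,
          intervalIntegral.integral_smul, ← add_sub_assoc]
        simp only [← semigroupCLM_apply, map_add, map_smul]
      -- The loss is discarded by its sign, never estimated: a bound for it would be quadratic and
      -- involve the heavier masses.
      have hle : f x m ≤ semigroup x (f0 m) + ∫ s in (0 : ℝ)..x,
          semigroup (x - s) ((d : ℝ) • f s m + totalGain R q (ρ s) m) := by
        rw [heqn]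
        refine sub_le_self _ (smul_L2_nonneg zero_le_two (integral_L2_nonneg hx.1 fun s _ => ?_))
        exact semigroup_nonneg _ (totalLoss_nonneg R (hρpos s) m)
      have hnorm := norm_le_norm_of_abs_le_abs
        (by rw [abs_of_nonneg (hpos x m), abs_of_nonneg ((hpos x m).trans hle)]; exact hle :
          |f x m| ≤ |semigroup x (f0 m) + ∫ s in (0 : ℝ)..x,
            semigroup (x - s) ((d : ℝ) • f s m + totalGain R q (ρ s) m)|)
      have h1 : ‖semigroup x (f0 m)‖ ≤ ‖f0‖ :=
        (norm_semigroup_le_norm hx.1 _).trans (norm_le_pi_norm f0 m)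
      have h2 : ‖∫ s in (0 : ℝ)..x, semigroup (x - s) ((d : ℝ) • f s m + totalGain R q (ρ s) m)‖ ≤
          ∫ s in (0 : ℝ)..x, (d * ‖f s m‖ + c) := by
        refine intervalIntegral.norm_integral_le_of_norm_le hx.1 ?_
          (((hfm.norm.const_smul (d : ℝ)).add continuous_const).intervalIntegrable _ _)
        refine Filter.Eventually.of_forall fun s hs => ?_
        refine (norm_semigroup_le_norm (sub_nonneg.2 hs.2) _).trans ((norm_add_le _ _).trans ?_)
        refine add_le_add (le_of_eq ?_) (hgain s ⟨hs.1.le, hs.2.trans hx.2⟩)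
        rw [norm_smul, Real.norm_of_nonneg (Nat.cast_nonneg d)]
      have h4 : IntervalIntegrable (fun s => d * ‖f s m‖) volume 0 x :=
        (hfm.norm.const_smul (d : ℝ)).intervalIntegrable _ _
      rw [intervalIntegral.integral_add h4
        (continuous_const.intervalIntegrable _ _), intervalIntegral.integral_const_mul,
        intervalIntegral.integral_const, smul_eq_mul, sub_zero] at h2
      have h3 : x * c ≤ c * T := by
        rw [mul_comm]
        exact mul_le_mul_of_nonneg_left hx.2 hc0
      linarith [norm_add_le (semigroup x (f0 m)) (∫ s in (0 : ℝ)..x,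
        semigroup (x - s) ((d : ℝ) • f s m + totalGain R q (ρ s) m))]
    have hgr := le_of_le_add_integral (Nat.cast_nonneg d)
      (((continuous_apply m).comp hf).norm.continuousOn) hkey t ht
    refine hgr.trans ?_
    have : 0 ≤ ‖f0‖ + c * T := by positivity
    gcongr
    exact ht.2

theorem continuous_const_smul_add_Q (R : ℝ) (q : ℕ) :
    Continuous fun f : State M d => (d : ℝ) • f + Q R q f :=
  (continuous_const_smul (d : ℝ)).add (continuous_Q R q)

/-- Passes from componentwise integrals to one integral in `L²_M`; integrability is recorded because
evaluating a component commutes with the integral only under it. -/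
theorem isMildSolution_iff {T : ℝ} {f : ℝ → State M d} :
    IsMildSolution R q f0 T f ↔ ContinuousOn f (Set.Icc 0 T) ∧ ∀ t ∈ Set.Icc (0 : ℝ) T,
      IntervalIntegrable (fun s => stateSemigroup (t - s) ((d : ℝ) • f s + Q R q (f s))) volume 0 t ∧
      f t = stateSemigroup t f0 +
        ∫ s in (0 : ℝ)..t, stateSemigroup (t - s) ((d : ℝ) • f s + Q R q (f s)) := by
  have hint : ContinuousOn f (Set.Icc 0 T) → ∀ t ∈ Set.Icc (0 : ℝ) T, IntervalIntegrable
      (fun s => stateSemigroup (t - s) ((d : ℝ) • f s + Q R q (f s))) volume 0 t := by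
    intro hf t ht
    apply ContinuousOn.intervalIntegrable
    rw [Set.uIcc_of_le ht.1]
    have hf' := hf.mono (Set.Icc_subset_Icc_right ht.2)
    exact continuousOn_clm_sub continuous_stateSemigroup t
      ((continuous_const_smul_add_Q R q).comp_continuousOn hf')
  constructor
  · rintro ⟨hf, h⟩
    refine ⟨hf, fun t ht => ⟨hint hf t ht, funext fun m => ?_⟩⟩
    rw [h t ht m, Pi.add_apply, intervalIntegral_apply (hint hf t ht)]
    rfl
  · rintro ⟨hf, h⟩
    refine ⟨hf, fun t ht m => ?_⟩
    have h1 := congrFun (h t ht).2 m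
    rw [Pi.add_apply, intervalIntegral_apply (h t ht).1] at h1
    exact h1

theorem IsMildSolution.mono {T T' : ℝ} {f : ℝ → State M d} (hf : IsMildSolution R q f0 T f)
    (h : T' ≤ T) : IsMildSolution R q f0 T' f :=
  ⟨hf.1.mono (Set.Icc_subset_Icc_right h), fun t ht => hf.2 t ⟨ht.1, ht.2.trans h⟩⟩

theorem IsMildSolution.congr {T : ℝ} {f g : ℝ → State M d} (hf : IsMildSolution R q f0 T f)
    (h : Set.EqOn g f (Set.Icc 0 T)) : IsMildSolution R q f0 T g := by
  refine ⟨hf.1.congr h, fun t ht m => ?_⟩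
  rw [h ht, hf.2 t ht m]
  congr 1
  refine intervalIntegral.integral_congr fun s hs => ?_
  rw [Set.uIcc_of_le ht.1] at hs
  simp only [h ⟨hs.1, hs.2.trans ht.2⟩]

/-- Mild solutions are unique. -/
theorem IsMildSolution.eqOn {T : ℝ} {f g : ℝ → State M d} (hf : IsMildSolution R q f0 T f)
    (hg : IsMildSolution R q f0 T g) : Set.EqOn g f (Set.Icc 0 T) := by
  rw [isMildSolution_iff] at hf hg
  obtain ⟨A, hA⟩ := (isCompact_Icc.image_of_continuousOn hf.1).isBounded.exists_norm_le
  obtain ⟨A', hA'⟩ := (isCompact_Icc.image_of_continuousOn hg.1).isBounded.exists_norm_le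
  -- Both solutions are bounded on the compact interval, so `Q` is Lipschitz along them and Grönwall
  -- with initial value `0` applies.
  set N : ℝ := max 0 (max A A') with hN
  obtain ⟨L, hL, hLip⟩ := exists_norm_Q_sub_le (M := M) (d := d) R q (le_max_left 0 (max A A'))
  have hfN : ∀ s ∈ Set.Icc 0 T, ∀ m, ‖f s m‖ ≤ N := fun s hs m => (norm_le_pi_norm (f s) m).trans
    ((hA _ ⟨s, hs, rfl⟩).trans ((le_max_left _ _).trans (le_max_right _ _)))
  have hgN : ∀ s ∈ Set.Icc 0 T, ∀ m, ‖g s m‖ ≤ N := fun s hs m => (norm_le_pi_norm (g s) m).trans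
    ((hA' _ ⟨s, hs, rfl⟩).trans ((le_max_right _ _).trans (le_max_right _ _)))
  have hcont : ContinuousOn (fun t => ‖g t - f t‖) (Set.Icc 0 T) := (hg.1.sub hf.1).norm
  have hgr := le_of_le_add_integral (a := 0) (b := d + L) (T := T) (by positivity) hcont ?_
  · intro t ht
    have := hgr t ht
    rw [zero_mul] at this
    exact sub_eq_zero.1 (norm_le_zero_iff.1 this)
  · intro t ht
    rw [zero_add, (hf.2 t ht).2, (hg.2 t ht).2, add_sub_add_left_eq_sub,
      ← intervalIntegral.integral_sub (hg.2 t ht).1 (hf.2 t ht).1,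
      ← intervalIntegral.integral_const_mul]
    refine intervalIntegral.norm_integral_le_of_norm_le ht.1 ?_ ?_
    · refine Filter.Eventually.of_forall fun s hs => ?_
      have hs' : s ∈ Set.Icc 0 T := ⟨hs.1.le, hs.2.trans ht.2⟩
      rw [← map_sub]
      refine (norm_stateSemigroup_le (sub_nonneg.2 hs.2) _).trans ?_
      have h1 : (d : ℝ) • g s + Q R q (g s) - ((d : ℝ) • f s + Q R q (f s)) =
          (d : ℝ) • (g s - f s) + (Q R q (g s) - Q R q (f s)) := by module
      rw [h1, add_mul]
      refine (norm_add_le _ _).trans (add_le_add (le_of_eq ?_) (hLip _ _ (hgN s hs') (hfN s hs')))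
      rw [norm_smul, Real.norm_of_nonneg (Nat.cast_nonneg d)]
    · apply ContinuousOn.intervalIntegrable
      rw [Set.uIcc_of_le ht.1]
      exact continuousOn_const.mul (hcont.mono (Set.Icc_subset_Icc_right ht.2))

theorem exists_isMildSolution (R : ℝ) (q : ℕ) (hf0 : ∀ m, 0 ≤ f0 m) {T : ℝ} (hT : 0 ≤ T) :
    ∃ f : ℝ → State M d, IsMildSolution R q f0 T f := by
  obtain ⟨B, hB⟩ := exists_bound_truncated_solution R q T f0
  -- The truncation level is chosen above the a priori bound, so the retraction acts as the identity
  -- along the solution.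
  have hN : 0 < max 1 B := lt_max_of_lt_left one_pos
  obtain ⟨f, hf, hpos, hsol⟩ := exists_truncated_solution R q hN hT hf0
  have hbound := hB _ f hN hf hpos hsol
  refine ⟨f, isMildSolution_iff.2 ⟨hf.continuousOn, fun t ht => ⟨?_, ?_⟩⟩⟩
  · exact (continuousOn_clm_sub continuous_stateSemigroup t
      ((continuous_const_smul_add_Q R q).comp hf).continuousOn).intervalIntegrable
  · rw [hsol t ht]
    congr 1
    refine intervalIntegral.integral_congr fun s hs => ?_
    rw [Set.uIcc_of_le ht.1] at hs
    have : (fun m => radial (max 1 B) (f s m)) = f s := funext fun m =>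
      radial_eq_self hN ((hbound s ⟨hs.1, hs.2.trans ht.2⟩ m).trans (le_max_right _ _))
    simp only [truncatedRhs, this]

theorem exists_global_isMildSolution (R : ℝ) (q : ℕ) (hf0 : ∀ m, 0 ≤ f0 m) :
    ∃ f : ℝ → State M d, ∀ T, IsMildSolution R q f0 T f := by
  have hex : ∀ T : ℝ, ∃ f : ℝ → State M d, IsMildSolution R q f0 T f := fun T => by
    obtain ⟨f, hf⟩ := exists_isMildSolution R q hf0 (le_max_left 0 T)
    exact ⟨f, hf.mono (le_max_right 0 T)⟩
  choose sol hsol using hex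
  -- Diagonal gluing: by uniqueness on `[0, t]`, the solutions for `T` and for `t` agree at the
  -- endpoint `t`.
  refine ⟨fun t => sol t t, fun T => (hsol T).congr fun t ht => ?_⟩
  exact ((hsol T).mono ht.2).eqOn (hsol t) ⟨ht.1, le_rfl⟩

end Global

end Smoluchowski

theorem mainTheorem4 (d M : ℕ) (hd : 1 ≤ d) (R : ℝ) (hR : 0 < R)
    (q : ℕ) (hq : q = 2 ∨ q = d + 1)
    (f0 : Smoluchowski.State M d) (hf0 : ∀ m : Fin M, 0 ≤ f0 m) :
    ∃ f : ℝ → Smoluchowski.State M d,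
      Smoluchowski.IsMaximalMildSolution R q f0 ⊤ f ∧
      (∀ (T : ℝ) (g : ℝ → Smoluchowski.State M d),
        Smoluchowski.IsMildSolution R q f0 T g → Set.EqOn g f (Set.Icc 0 T)) ∧
      (∀ (Tmax : ℝ≥0∞) (g : ℝ → Smoluchowski.State M d),
        Smoluchowski.IsMaximalMildSolution R q f0 Tmax g → Tmax = ⊤) := by
  obtain ⟨f, hf⟩ := Smoluchowski.exists_global_isMildSolution R q hf0
  refine ⟨f, ⟨ENNReal.zero_lt_top, fun T _ _ => hf T, fun T _ h => ?_⟩,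
    fun T g hg => (hf T).eqOn hg, fun Tmax g hg => ?_⟩
  · exact absurd (top_le_iff.1 h) ENNReal.ofReal_ne_top
  · by_contra hne
    obtain ⟨hpos, hmild, hmax⟩ := hg
    have hT : 0 < Tmax.toReal := ENNReal.toReal_pos hpos.ne' hne
    -- If `Tmax` were finite, the global `f` would extend `g` up to `Tmax`. Agreement at each `t <
    -- Tmax` follows from uniqueness on `[0, S]` with `t < S < Tmax`.
    refine hmax Tmax.toReal hT (ENNReal.ofReal_toReal hne).ge ⟨f, hf _, fun t ht0 ht => ?_⟩
    obtain ⟨S, htS, hS⟩ := exists_between ht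
    have hSt : S ≠ ⊤ := (hS.trans_le le_top).ne
    have htS' : t ≤ S.toReal := by
      rw [← ENNReal.ofReal_le_iff_le_toReal hSt]
      exact htS.le
    have hS0 : 0 < S.toReal := ENNReal.toReal_pos (bot_le.trans_lt htS).ne' hSt
    have hgS := hmild S.toReal hS0 (by rwa [ENNReal.ofReal_toReal hSt])
    exact hgS.eqOn (hf S.toReal) ⟨ht0, htS'⟩
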